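/- Let $n\ge 2$, let $\alpha\in\mathbb R$, and let $A,B,K$ be real numbers. There is a constant $C$, depending only on $n,\alpha,A,B,K$, with the following property. Let $M=\{\rho(x)x : x\in\mathbb S^n\}\subset\mathbb R^{n+1}$ be a closed hypersurface, star-shaped about the origin, whose radial function $\rho:\mathbb S^n\to(0,\infty)$ is of class $C^4$ (for instance, $M$ smooth), with the $C^1$ bound $K^{-1}\le\rho\le K$ and $|\nabla\rho|\le K$ on $\mathbb S^n$. Let $N$ be the unit outer normal of $M$, let $h$ be its second fundamental form with respect to $N$, $h(v,w)=\langle D_vN,w\rangle$ for tangent vectors $v,w$, and let $\lambda(h)=(\lambda_1,\dots,\lambda_n)$ be its principal curvatures. Let $\varphi\in C^2(\mathbb R^{n+1})$ be positive, with $\varphi$, $D\varphi$ and $D^2\varphi$ bounded in norm by $A$ on $M$, and $1/\varphi\le B$ on $M$. Suppose that $M$ is $2$-convex, that is, $\sigma_1(\lambda(h))>0$ and $\sigma_2(\lambda(h))>0$ everywhere on $M$, where $\sigma_k$ is the $k$-th elementary symmetric function, that $$\sigma_2(\lambda(h))=\varphi(X)\,\langle X,N\rangle^{\alpha}\qquad\text{for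 all }X\in M,$$ and that $\alpha<1+\delta$, where $\delta=\inf_{X\in M}\langle X,N\rangle^2/|X|^2$. Then $$h(\xi,\xi)\le C\qquad\text{for every } X\in M \text{ and every unit vector } \xi\in T_XM ,$$ that is, the largest principal curvature of $M$ is at most $C$. -/

import Mathlib

open scoped RealInnerProductSpace

noncomputable section

namespace StarShaped

/-- The ambient Euclidean space `ℝ^{n+1}`. -/
abbrev E (n : ℕ) := EuclideanSpace ℝ (Fin (n + 1))

variable {n : ℕ}

/-- The extension of a function on the unit sphere `𝕊ⁿ` to `ℝ^{n+1} \ {0}` that is constant on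
rays from the origin. Only the values of `ρ` on the unit sphere are used. -/
def radialExt (ρ : E n → ℝ) (X : E n) : ℝ := ρ (‖X‖⁻¹ • X)

/-- `ρ` is (on the unit sphere) a positive function of class `C^k`. -/
structure IsRadialFunction (k : WithTop ℕ∞) (ρ : E n → ℝ) : Prop where
  pos : ∀ x : E n, ‖x‖ = 1 → 0 < ρ x
  contDiffOn : ContDiffOn ℝ k (radialExt ρ) {0}ᶜ

/-- The closed hypersurface `M = {ρ(x) x : x ∈ 𝕊ⁿ}`, star-shaped about the origin, with radial
function `ρ`. -/
def hypersurface (ρ : E n → ℝ) : Set (E n) := {X | ∃ x : E n, ‖x‖ = 1 ∧ X = ρ x • x}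

/-- The differential of `ρ` as a function on the sphere at a unit vector `x`. The radial
derivative of the extension vanishes, so the norm of this functional is `|∇ρ(x)|`, the length of
the gradient of `ρ` on the unit sphere. -/
def sphereDeriv (ρ : E n → ℝ) (x : E n) : E n →L[ℝ] ℝ := fderiv ℝ (radialExt ρ) x

/-- The `C¹` bound on `M`: `K⁻¹ ≤ ρ ≤ K` and `|∇ρ| ≤ K` on the unit sphere. -/
def C1Bound (ρ : E n → ℝ) (K : ℝ) : Prop :=
  ∀ x : E n, ‖x‖ = 1 → K⁻¹ ≤ ρ x ∧ ρ x ≤ K ∧ ‖sphereDeriv ρ x‖ ≤ K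

/-- The function `X ↦ |X| / ρ(X / |X|)`, which is `< 1` inside `M`, `= 1` on `M` and `> 1`
outside. -/
def definingFun (ρ : E n → ℝ) (X : E n) : ℝ := ‖X‖ / radialExt ρ X

/-- The unit outer normal `N` of `M` at a point `X` of `M`: the normalized gradient of the
defining function. (The formula makes sense off the origin, and there it extends `N` to a
neighbourhood of `M`.) -/
def normal (ρ : E n → ℝ) (X : E n) : E n :=
  ‖gradient (definingFun ρ) X‖⁻¹ • gradient (definingFun ρ) X

/-- The tangent space `T_X M`, the orthogonal complement of the normal. -/
abbrev tangent (ρ : E n → ℝ) (X : E n) : Submodule ℝ (E n) := (ℝ ∙ normal ρ X)ᗮ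

/-- The second fundamental form `h(v, w) = ⟨D_v N, w⟩` on `T_X M`, with respect to the outer
normal (positive for round spheres). -/
def secondFF (ρ : E n → ℝ) (X : E n) (v w : tangent ρ X) : ℝ :=
  ⟪fderiv ℝ (normal ρ) X (v : E n), (w : E n)⟫

/-- The Weingarten map `v ↦ D_v N` of `T_X M`. -/
def shapeOperator (ρ : E n → ℝ) (X : E n) : tangent ρ X →ₗ[ℝ] tangent ρ X :=
  ((tangent ρ X).orthogonalProjectionOnto.comp
    ((fderiv ℝ (normal ρ) X).comp (tangent ρ X).subtypeL)).toLinearMap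

/-- The Weingarten map represents the second fundamental form in the induced metric. -/
theorem inner_shapeOperator (ρ : E n → ℝ) (X : E n) (v w : tangent ρ X) :
    ⟪shapeOperator ρ X v, w⟫ = secondFF ρ X v w := by
  simp [shapeOperator, secondFF]

/-- The principal curvatures `λ(h_{ij})` of `M` at `X`: the eigenvalues of the Weingarten map,
with multiplicity. -/
def principalCurvatures (ρ : E n → ℝ) (X : E n) : Multiset ℝ :=
  (shapeOperator ρ X).charpoly.roots

/-- `σ_k` of the principal curvatures of `M` at `X`. -/
def sigma (k : ℕ) (ρ : E n → ℝ) (X : E n) : ℝ := (principalCurvatures ρ X).esymm k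

/-- `M` is `k`-convex: its principal curvatures lie in the Gårding cone `Γ_k` everywhere. -/
def IsKConvex (k : ℕ) (ρ : E n → ℝ) : Prop :=
  ∀ X ∈ hypersurface ρ, ∀ i : ℕ, 1 ≤ i → i ≤ k → 0 < sigma i ρ X

/-- The support function `⟨X, N⟩`. -/
def support (ρ : E n → ℝ) (X : E n) : ℝ := ⟪X, normal ρ X⟫

/-- `δ = inf_M ⟨X, N⟩² / |X|²`. -/
def delta (ρ : E n → ℝ) : ℝ :=
  sInf ((fun X => support ρ X ^ 2 / ‖X‖ ^ 2) '' hypersurface ρ)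

end StarShaped

end

/-! The maximum principle is applied to h(ξ,ξ)/⟨X,N⟩ on the unit tangent bundle. By compactness a
maximum exists over some X₀, and its value is at most κ_k/u, where κ_k is the largest principal
curvature at X₀ and u the support function there. The C¹ bound pinches the support function between
positive constants, so it suffices to bound κ_k.

Covariant derivatives are avoided by writing M near X₀ as the graph of -w over its tangent plane
(`IsRadialFunction.exists_graph`), with an orthonormal frame e of principal directions. With D = 1 +
|∂w|² and U = √D times the support function, maximality gives w_kk ≤ (κ_k/u)(1 + w_k²)U, with
equality at 0. The prescribed curvature equation becomes `hessianSigma` = 2 D^(2-α/2) φ U^α. Both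
are expanded to second order along the lines t • e_i. The second-order maximality conditions,
weighted by σ₁ - κ_i ≥ 0 and summed, are combined with the equation differentiated twice along e_k.
The fourth derivatives then cancel, and so do the terms of cubic type κ_k³(σ₁ - κ_k).

The third derivatives enter through ∑ w_ijk² - (∑ w_iik)². Its off-diagonal squares are dropped.
Concavity of σ₂^(1/2) controls the rest, in the sharpened form `neg_lorentz_ge`, which keeps a
square in the k-th coordinate. With y = ⟨X₀,e_k⟩/u, the first-order condition gives w_kkk = κ_k² y,
so `concavity_gain` extracts (2 - 2α) f κ_k² y², where f = σ₂(X₀), up to terms of lower order in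
κ_k. Altogether f κ_k² (2-α)(1 + (1-α)y²) ≤ C(1 + κ_k) (`curvature_inequality`). Since y² ≤ |X₀|²/u²
- 1, the hypothesis α < 1 + δ keeps the last factor on the left at least u²/|X₀|²
(`one_add_mul_sq_ge`), and κ_k is bounded. -/

open scoped RealInnerProductSpace

open Filter Topology

noncomputable section

namespace StarShaped

/-! ### Second-order jets in one variable and commuting directional derivatives -/

section

/-- `f` is differentiable near `0` and twice differentiable at `0`, with value `a`, derivative `b`
and second derivative `c` at `0`. -/
def HasTwoDeriv (f : ℝ → ℝ) (a b c : ℝ) : Prop :=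
  f 0 = a ∧ ∃ f' : ℝ → ℝ, (∀ᶠ t in 𝓝 0, HasDerivAt f (f' t) t) ∧ f' 0 = b ∧ HasDerivAt f' c 0

namespace HasTwoDeriv

variable {f g : ℝ → ℝ} {a b c a' b' c' : ℝ}

theorem hasDerivAt (hf : HasTwoDeriv f a b c) : HasDerivAt f b 0 := by
  obtain ⟨-, f', h, hb, -⟩ := hf
  exact hb ▸ h.self_of_nhds

theorem const (k : ℝ) : HasTwoDeriv (fun _ => k) k 0 0 :=
  ⟨rfl, fun _ => 0, Eventually.of_forall fun t => hasDerivAt_const t k, rfl, hasDerivAt_const _ _⟩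

theorem id : HasTwoDeriv (fun t => t) 0 1 0 :=
  ⟨rfl, fun _ => 1, Eventually.of_forall fun t => hasDerivAt_id t, rfl, hasDerivAt_const _ _⟩

theorem add (hf : HasTwoDeriv f a b c) (hg : HasTwoDeriv g a' b' c') :
    HasTwoDeriv (fun t => f t + g t) (a + a') (b + b') (c + c') := by
  obtain ⟨ha, f', h, hb, hc⟩ := hf
  obtain ⟨ha', g', h', hb', hc'⟩ := hg
  refine ⟨by simp [ha, ha'], fun t => f' t + g' t, ?_, by simp [hb, hb'], hc.add hc'⟩
  filter_upwards [h, h'] with t ht ht' using ht.add ht'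

theorem mul (hf : HasTwoDeriv f a b c) (hg : HasTwoDeriv g a' b' c') :
    HasTwoDeriv (fun t => f t * g t) (a * a') (b * a' + a * b') (c * a' + 2 * b * b' + a * c') := by
  have hf0 := hf.hasDerivAt
  have hg0 := hg.hasDerivAt
  obtain ⟨ha, f', h, hb, hc⟩ := hf
  obtain ⟨ha', g', h', hb', hc'⟩ := hg
  refine ⟨by simp [ha, ha'], fun t => f' t * g t + f t * g' t, ?_, by simp [ha, ha', hb, hb'], ?_⟩
  · filter_upwards [h, h'] with t ht ht' using ht.mul ht'
  · refine ((hc.mul hg0).add (hf0.mul hc')).congr_deriv ?_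
    rw [ha, ha', hb, hb']
    ring

theorem const_mul (k : ℝ) (hf : HasTwoDeriv f a b c) :
    HasTwoDeriv (fun t => k * f t) (k * a) (k * b) (k * c) := by
  simpa using (const k).mul hf

theorem neg (hf : HasTwoDeriv f a b c) : HasTwoDeriv (fun t => -f t) (-a) (-b) (-c) := by
  simpa using hf.const_mul (-1)

theorem sub (hf : HasTwoDeriv f a b c) (hg : HasTwoDeriv g a' b' c') :
    HasTwoDeriv (fun t => f t - g t) (a - a') (b - b') (c - c') := by
  simpa [sub_eq_add_neg] using hf.add hg.neg

theorem sq (hf : HasTwoDeriv f a b c) :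
    HasTwoDeriv (fun t => f t ^ 2) (a ^ 2) (2 * a * b) (2 * a * c + 2 * b ^ 2) := by
  convert hf.mul hf using 1 <;> first | (funext t; ring) | ring

theorem sum {ι : Type*} (s : Finset ι) {f : ι → ℝ → ℝ} {a b c : ι → ℝ}
    (h : ∀ i ∈ s, HasTwoDeriv (f i) (a i) (b i) (c i)) :
    HasTwoDeriv (fun t => ∑ i ∈ s, f i t) (∑ i ∈ s, a i) (∑ i ∈ s, b i) (∑ i ∈ s, c i) := by
  classical
  induction s using Finset.induction_on with
  | empty => simpa using const 0
  | insert i s hi ih =>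
    simp only [Finset.sum_insert hi]
    exact (h i (Finset.mem_insert_self _ _)).add
      (ih fun j hj => h j (Finset.mem_insert_of_mem hj))

theorem rpow (hf : HasTwoDeriv f a b c) (ha : 0 < a) (p : ℝ) :
    HasTwoDeriv (fun t => f t ^ p) (a ^ p) (p * a ^ (p - 1) * b)
      (p * a ^ (p - 1) * c + p * (p - 1) * a ^ (p - 2) * b ^ 2) := by
  have hf0 := hf.hasDerivAt
  obtain ⟨hfa, f', h, hb, hc⟩ := hf
  have hpos : ∀ᶠ t in 𝓝 0, 0 < f t :=
    hf0.continuousAt.eventually (lt_mem_nhds (by rw [hfa]; exact ha))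
  refine ⟨by simp [hfa], fun t => f' t * p * f t ^ (p - 1), ?_, by simp [hfa, hb]; ring, ?_⟩
  · filter_upwards [h, hpos] with t ht hp using ht.rpow_const (Or.inl hp.ne')
  · have h1 := hf0.rpow_const (p := p - 1) (Or.inl (by rw [hfa]; exact ha.ne'))
    refine ((hc.mul_const p).mul h1).congr_deriv ?_
    rw [hfa, hb, show p - 1 - 1 = p - 2 by ring]
    ring

theorem congr (hf : HasTwoDeriv f a b c) (h : f =ᶠ[𝓝 0] g) : HasTwoDeriv g a b c := by
  obtain ⟨ha, f', h', hb, hc⟩ := hf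
  refine ⟨h.self_of_nhds ▸ ha, f', ?_, hb, hc⟩
  filter_upwards [h', h.eventually_nhds] with t ht ht'
  exact ht.congr_of_eventuallyEq (EventuallyEq.symm ht')

theorem unique (hf : HasTwoDeriv f a b c) (hg : HasTwoDeriv f a' b' c') :
    a = a' ∧ b = b' ∧ c = c' := by
  have hf0 := hf.hasDerivAt
  have hg0 := hg.hasDerivAt
  obtain ⟨ha, f', h, hb, hc⟩ := hf
  obtain ⟨ha', g', h', hb', hcg⟩ := hg
  refine ⟨ha.symm.trans ha', hf0.unique hg0, ?_⟩
  have : f' =ᶠ[𝓝 0] g' := by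
    filter_upwards [h, h'] with t ht ht' using ht.unique ht'
  exact (hc.congr_of_eventuallyEq this.symm).unique hcg

/-- First and second order conditions at a local maximum. -/
theorem of_isLocalMax (hf : HasTwoDeriv f a b c) (hmax : IsLocalMax f 0) : b = 0 ∧ c ≤ 0 := by
  have hb0 := hmax.hasDerivAt_eq_zero hf.hasDerivAt
  refine ⟨hb0, ?_⟩
  by_contra! hc0
  have hcont := hf.hasDerivAt.continuousAt
  have hf2 := hf
  obtain ⟨ha, f', h, hb, hc⟩ := hf
  have hd : deriv f =ᶠ[𝓝 0] f' := h.mono fun t ht => ht.deriv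
  -- If c > 0, the second derivative test makes 0 a local minimum as well. Then `f` is locally
  -- constant, and uniqueness of jets gives c = 0.
  have hmin : IsLocalMin f 0 := by
    refine isLocalMin_of_deriv_deriv_pos ?_ ?_ hcont
    · rw [hd.deriv_eq, hc.deriv]; exact hc0
    · rw [hd.self_of_nhds, hb, hb0]
  have hconst : (fun _ => a) =ᶠ[𝓝 0] f := by
    filter_upwards [hmin, hmax] with t h1 h2
    rw [← ha]; exact le_antisymm h1 h2
  have := (((const a).congr hconst).unique hf2).2.2
  linarith

end HasTwoDeriv

section DirectionalDerivative

variable {V : Type*} [NormedAddCommGroup V] [NormedSpace ℝ V]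

/-- The directional derivative `∂_v g` as a function of the point. -/
def dirDeriv (v : V) (g : V → ℝ) (z : V) : ℝ := fderiv ℝ g z v

variable {g g₁ g₂ : V → ℝ} {z : V}

theorem contDiffAt_dirDeriv {k m : WithTop ℕ∞} (hg : ContDiffAt ℝ m g z) (h : k + 1 ≤ m) (v : V) :
    ContDiffAt ℝ k (dirDeriv v g) z :=
  (hg.fderiv_right h).clm_apply contDiffAt_const

theorem dirDeriv_congr (h : g₁ =ᶠ[𝓝 z] g₂) (v : V) : dirDeriv v g₁ =ᶠ[𝓝 z] dirDeriv v g₂ := by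
  filter_upwards [h.fderiv (𝕜 := ℝ)] with y hy
  simp [dirDeriv, hy]

theorem dirDeriv_comm (hg : ContDiffAt ℝ 2 g z) (v v' : V) :
    dirDeriv v (dirDeriv v' g) z = dirDeriv v' (dirDeriv v g) z := by
  have hd : DifferentiableAt ℝ (fderiv ℝ g) z :=
    (hg.fderiv_right (m := 1) (by norm_num)).differentiableAt (by norm_num)
  have key : ∀ a b : V, dirDeriv a (dirDeriv b g) z = fderiv ℝ (fderiv ℝ g) z a b := by
    intro a b
    have := (hd.hasFDerivAt.clm_apply (hasFDerivAt_const b z)).fderiv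
    change fderiv ℝ (fun y => fderiv ℝ g y b) z a = _
    rw [this]
    simp
  rw [key, key]
  exact (hg.isSymmSndFDerivAt (by simp)) v v'

theorem dirDeriv_comm_eventually (hg : ContDiffAt ℝ 2 g z) (v v' : V) :
    dirDeriv v (dirDeriv v' g) =ᶠ[𝓝 z] dirDeriv v' (dirDeriv v g) := by
  filter_upwards [hg.eventually (by norm_num)] with y hy using dirDeriv_comm hy v v'

theorem hasTwoDeriv_line (hg : ContDiffAt ℝ 2 g 0) (v : V) :
    HasTwoDeriv (fun t : ℝ => g (t • v)) (g 0) (dirDeriv v g 0) (dirDeriv v (dirDeriv v g) 0) := by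
  have hline : ∀ t : ℝ, HasDerivAt (fun t : ℝ => t • v) v t := fun t => by
    simpa using (hasDerivAt_id t).smul_const v
  have hcont : Tendsto (fun t : ℝ => t • v) (𝓝 0) (𝓝 0) := by
    have := (hline 0).continuousAt.tendsto
    simpa using this
  have hstep : ∀ {k : V → ℝ} {t : ℝ}, DifferentiableAt ℝ k (t • v) →
      HasDerivAt (fun t : ℝ => k (t • v)) (dirDeriv v k (t • v)) t := fun {k t} hk =>
    hk.hasFDerivAt.comp_hasDerivAt t (hline t)
  refine ⟨by simp, fun t => dirDeriv v g (t • v), ?_, by simp, ?_⟩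
  · filter_upwards [hcont.eventually (hg.eventually (by norm_num))] with t ht
    exact hstep (ht.differentiableAt (by norm_num))
  · have h1 : ContDiffAt ℝ 1 (dirDeriv v g) 0 := contDiffAt_dirDeriv hg (by norm_num) v
    have := hstep (k := dirDeriv v g) (t := 0) (by simpa using h1.differentiableAt (by norm_num))
    simpa using this

/-- The mixed fourth derivatives `∂_a ∂_a ∂_b ∂_b` and `∂_b ∂_b ∂_a ∂_a` agree. -/
theorem dirDeriv_fourth_comm (hg : ContDiffAt ℝ 4 g z) (a b : V) :
    dirDeriv a (dirDeriv a (dirDeriv b (dirDeriv b g))) z =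
      dirDeriv b (dirDeriv b (dirDeriv a (dirDeriv a g))) z := by
  have hb : ∀ v, ContDiffAt ℝ 3 (dirDeriv v g) z := contDiffAt_dirDeriv hg (by norm_num)
  have hb2 : ∀ v, ContDiffAt ℝ 2 (dirDeriv v g) z := fun v => (hb v).of_le (by norm_num)
  have hbb : ∀ v v', ContDiffAt ℝ 2 (dirDeriv v' (dirDeriv v g)) z := fun v v' =>
    contDiffAt_dirDeriv (hb v) (by norm_num) v'
  have h1 := dirDeriv_comm_eventually (hb2 b) a b
  have h2 := dirDeriv_comm_eventually (hg.of_le (by norm_num)) a b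
  have h3 : dirDeriv a (dirDeriv b (dirDeriv b g)) =ᶠ[𝓝 z] dirDeriv b (dirDeriv b (dirDeriv a g)) :=
    h1.trans (dirDeriv_congr h2 b)
  rw [(dirDeriv_congr h3 a).self_of_nhds, dirDeriv_comm (hbb a b)]
  exact (dirDeriv_congr (dirDeriv_comm_eventually (hb2 a) a b) b).self_of_nhds

end DirectionalDerivative

end

/-! ### The defining function, the normal and bounds for the support function -/

section

variable {n : ℕ} {ρ : E n → ℝ} {X : E n}

theorem radialExt_smul {t : ℝ} (ht : 0 < t) (X : E n) : radialExt ρ (t • X) = radialExt ρ X := by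
  unfold radialExt
  rw [norm_smul, Real.norm_of_nonneg ht.le, smul_smul, mul_inv_rev, mul_assoc,
    inv_mul_cancel₀ ht.ne', mul_one]

theorem radialExt_of_norm_eq_one (hX : ‖X‖ = 1) : radialExt ρ X = ρ X := by
  simp [radialExt, hX]

theorem definingFun_smul {t : ℝ} (ht : 0 < t) (X : E n) :
    definingFun ρ (t • X) = t * definingFun ρ X := by
  unfold definingFun
  rw [radialExt_smul ht, norm_smul, Real.norm_of_nonneg ht.le, mul_div_assoc]

theorem ne_zero_of_definingFun_eq_one (h : definingFun ρ X = 1) : X ≠ 0 := by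
  rintro rfl
  simp [definingFun] at h

theorem delta_le (hX : X ∈ hypersurface ρ) : delta ρ ≤ support ρ X ^ 2 / ‖X‖ ^ 2 :=
  csInf_le ⟨0, by rintro _ ⟨Y, -, rfl⟩; positivity⟩ ⟨X, hX, rfl⟩

namespace IsRadialFunction

theorem radialExt_pos (hρ : IsRadialFunction 4 ρ) (hX : X ≠ 0) : 0 < radialExt ρ X :=
  hρ.pos _ (norm_smul_inv_norm hX)

theorem contDiffAt_radialExt (hρ : IsRadialFunction 4 ρ) (hX : X ≠ 0) :
    ContDiffAt ℝ 4 (radialExt ρ) X :=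
  hρ.contDiffOn.contDiffAt (isOpen_compl_singleton.mem_nhds hX)

theorem contDiffAt_definingFun (hρ : IsRadialFunction 4 ρ) (hX : X ≠ 0) :
    ContDiffAt ℝ 4 (definingFun ρ) X :=
  (contDiffAt_norm ℝ hX).div (hρ.contDiffAt_radialExt hX) (hρ.radialExt_pos hX).ne'

theorem mem_hypersurface_iff (hρ : IsRadialFunction 4 ρ) :
    X ∈ hypersurface ρ ↔ definingFun ρ X = 1 := by
  constructor
  · rintro ⟨x, hx, rfl⟩
    have := hρ.pos x hx
    rw [definingFun_smul this, definingFun, radialExt_of_norm_eq_one hx, hx]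
    field_simp
  · intro h
    have hX := ne_zero_of_definingFun_eq_one h
    refine ⟨‖X‖⁻¹ • X, norm_smul_inv_norm hX, ?_⟩
    have h1 : ‖X‖ = radialExt ρ X := by
      rwa [definingFun, div_eq_one_iff_eq (hρ.radialExt_pos hX).ne'] at h
    change X = radialExt ρ X • _
    rw [← h1, smul_smul, mul_inv_cancel₀ (norm_ne_zero_iff.2 hX), one_smul]

/-- Euler's identity for a function homogeneous of degree one. It shows that the gradient does not
vanish and that on M the support function is the reciprocal of the gradient's norm. -/
theorem fderiv_definingFun_self (hρ : IsRadialFunction 4 ρ) (hX : X ≠ 0) :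
    fderiv ℝ (definingFun ρ) X X = definingFun ρ X := by
  have hd := ((hρ.contDiffAt_definingFun hX).differentiableAt (by norm_num)).hasFDerivAt
  have hl : HasDerivAt (fun t : ℝ => t • X) X 1 := by
    simpa using (hasDerivAt_id (1 : ℝ)).smul_const X
  have h1 : HasDerivAt (fun t : ℝ => definingFun ρ (t • X)) (fderiv ℝ (definingFun ρ) X X) 1 :=
    HasFDerivAt.comp_hasDerivAt (l := definingFun ρ) (f := fun t : ℝ => t • X) 1
      (by simpa using hd) hl
  have h2 : HasDerivAt (fun t : ℝ => t * definingFun ρ X) (definingFun ρ X) 1 := by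
    simpa using (hasDerivAt_id (1 : ℝ)).mul_const (definingFun ρ X)
  refine h1.unique (h2.congr_of_eventuallyEq ?_)
  filter_upwards [lt_mem_nhds (zero_lt_one (α := ℝ))] with t ht using definingFun_smul ht X

theorem fderiv_definingFun_smul (hρ : IsRadialFunction 4 ρ) {t : ℝ} (ht : 0 < t) (hX : X ≠ 0) :
    fderiv ℝ (definingFun ρ) (t • X) = fderiv ℝ (definingFun ρ) X := by
  have hd : ∀ {Y : E n}, Y ≠ 0 → HasFDerivAt (definingFun ρ) (fderiv ℝ (definingFun ρ) Y) Y :=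
    fun hY => ((hρ.contDiffAt_definingFun hY).differentiableAt (by norm_num)).hasFDerivAt
  have h1 := (hd (smul_ne_zero ht.ne' hX)).comp X ((hasFDerivAt_id X).const_smul t)
  have h2 := (hd hX).const_mul t
  have he : (definingFun ρ ∘ fun Y : E n => t • Y) = fun Y => t * definingFun ρ Y :=
    funext fun Y => definingFun_smul ht Y
  ext v
  have := DFunLike.congr_fun ((he ▸ h1 : HasFDerivAt _ _ X).unique h2) v
  simpa [ht.ne'] using this

theorem contDiffAt_gradient (hρ : IsRadialFunction 4 ρ) (hX : X ≠ 0) :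
    ContDiffAt ℝ 3 (gradient (definingFun ρ)) X := by
  have h := (hρ.contDiffAt_definingFun hX).fderiv_right (m := 3) (by norm_num)
  exact ((InnerProductSpace.toDual ℝ (E n)).symm.toContinuousLinearEquiv.contDiff.contDiffAt).comp
    X h

theorem gradient_ne_zero (hρ : IsRadialFunction 4 ρ) (hX : X ≠ 0) :
    gradient (definingFun ρ) X ≠ 0 := by
  intro h
  have h1 := hρ.fderiv_definingFun_self hX
  rw [← inner_gradient_left, h, inner_zero_left] at h1
  exact (div_pos (norm_pos_iff.2 hX) (hρ.radialExt_pos hX)).ne h1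

theorem contDiffAt_normal (hρ : IsRadialFunction 4 ρ) (hX : X ≠ 0) :
    ContDiffAt ℝ 3 (normal ρ) X := by
  have h := hρ.contDiffAt_gradient hX
  have h0 := hρ.gradient_ne_zero hX
  exact ((h.norm ℝ h0).inv (norm_ne_zero_iff.2 h0)).smul h

theorem norm_normal (hρ : IsRadialFunction 4 ρ) (hX : X ≠ 0) : ‖normal ρ X‖ = 1 :=
  norm_smul_inv_norm (hρ.gradient_ne_zero hX)

theorem support_eq (hρ : IsRadialFunction 4 ρ) (hX : X ∈ hypersurface ρ) :
    support ρ X = ‖gradient (definingFun ρ) X‖⁻¹ := by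
  rw [hρ.mem_hypersurface_iff] at hX
  rw [support, normal, inner_smul_right, real_inner_comm, inner_gradient_left,
    hρ.fderiv_definingFun_self (ne_zero_of_definingFun_eq_one hX), hX, mul_one]

theorem support_pos (hρ : IsRadialFunction 4 ρ) (hX : X ∈ hypersurface ρ) : 0 < support ρ X := by
  rw [hρ.support_eq hX]
  exact inv_pos.2 (norm_pos_iff.2 (hρ.gradient_ne_zero
    (ne_zero_of_definingFun_eq_one (hρ.mem_hypersurface_iff.1 hX))))

theorem norm_le (hρ : IsRadialFunction 4 ρ) {K : ℝ} (hK : C1Bound ρ K) (hX : X ∈ hypersurface ρ) :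
    ‖X‖ ≤ K := by
  obtain ⟨x, hx, rfl⟩ := hX
  rw [norm_smul, hx, mul_one, Real.norm_of_nonneg (hρ.pos x hx).le]
  exact (hK x hx).2.1

theorem bound_pos (hρ : IsRadialFunction 4 ρ) {K : ℝ} (hK : C1Bound ρ K)
    (hX : X ∈ hypersurface ρ) : 0 < K := by
  obtain ⟨x, hx, -⟩ := hX
  exact (hρ.pos x hx).trans_le (hK x hx).2.1

/-- The gradient of the defining function is constant along rays, so its norm can be estimated on
the unit sphere. There the product rule for |Y| · ρ⁻¹ gives at most K + K² · K. -/
theorem support_ge (hρ : IsRadialFunction 4 ρ) {K : ℝ} (hK : C1Bound ρ K)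
    (hX : X ∈ hypersurface ρ) :
    (K + K ^ 3)⁻¹ ≤ support ρ X := by
  have hK0 := hρ.bound_pos hK hX
  have hX0 := ne_zero_of_definingFun_eq_one (hρ.mem_hypersurface_iff.1 hX)
  rw [hρ.support_eq hX]
  refine inv_anti₀ (norm_pos_iff.2 (hρ.gradient_ne_zero hX0)) ?_
  obtain ⟨x, hx, rfl⟩ := hX
  have hx0 : x ≠ 0 := by rintro rfl; simp at hx
  have hr := hρ.pos x hx
  obtain ⟨h1, -, h3⟩ := hK x hx
  have hgrad : ∀ Y, ‖gradient (definingFun ρ) Y‖ = ‖fderiv ℝ (definingFun ρ) Y‖ := fun Y =>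
    (InnerProductSpace.toDual ℝ (E n)).symm.norm_map _
  rw [hgrad, hρ.fderiv_definingFun_smul hr hx0]
  have hre := radialExt_of_norm_eq_one (ρ := ρ) hx
  have hdn : HasFDerivAt (fun Y : E n => ‖Y‖) (fderiv ℝ (fun Y : E n => ‖Y‖) x) x :=
    ((contDiffAt_norm ℝ hx0 (n := 1)).differentiableAt (by norm_num)).hasFDerivAt
  have hdr : HasFDerivAt (radialExt ρ) (sphereDeriv ρ x) x :=
    ((hρ.contDiffAt_radialExt hx0).differentiableAt (by norm_num)).hasFDerivAt
  have hdi := (hasDerivAt_inv (x := radialExt ρ x)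
    (by rw [hre]; exact hr.ne')).comp_hasFDerivAt x hdr
  have hG : definingFun ρ = (fun Y => ‖Y‖) * (fun y => y⁻¹) ∘ radialExt ρ :=
    funext fun Y => div_eq_mul_inv _ _
  rw [hG, (hdn.mul hdi).fderiv, hre, hx, one_smul]
  have hn1 : ‖fderiv ℝ (fun Y : E n => ‖Y‖) x‖ ≤ 1 := by
    simpa using norm_fderiv_le_of_lipschitz ℝ (x₀ := x) (lipschitzWith_one_norm (E := E n))
  have hinv : (ρ x)⁻¹ ≤ K := by
    rw [← inv_inv K]; exact inv_anti₀ (inv_pos.2 hK0) h1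
  have hinv0 : 0 < (ρ x)⁻¹ := inv_pos.2 hr
  refine (norm_add_le _ _).trans ?_
  rw [norm_smul, norm_smul, add_comm K]
  have e1 : ‖-(ρ x ^ 2)⁻¹‖ ≤ K ^ 2 := by
    rw [norm_neg, ← inv_pow, Real.norm_of_nonneg (by positivity)]
    gcongr
  have e2 : ‖((radialExt ρ) x)⁻¹‖ ≤ K := by
    rw [hre, Real.norm_of_nonneg hinv0.le]; exact hinv
  calc _ ≤ K ^ 2 * K + K * 1 := by
        gcongr
        simpa [hre] using e2
    _ = _ := by ring

theorem support_le_norm (hρ : IsRadialFunction 4 ρ) (hX : X ∈ hypersurface ρ) :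
    support ρ X ≤ ‖X‖ := by
  have := real_inner_le_norm X (normal ρ X)
  rwa [hρ.norm_normal (ne_zero_of_definingFun_eq_one (hρ.mem_hypersurface_iff.1 hX)),
    mul_one] at this

theorem isCompact_hypersurface (hρ : IsRadialFunction 4 ρ) : IsCompact (hypersurface ρ) := by
  have : hypersurface ρ = (fun x => radialExt ρ x • x) '' Metric.sphere 0 1 := by
    ext X
    simp only [hypersurface, Set.mem_ofPred_eq, Set.mem_image, mem_sphere_zero_iff_norm]
    refine exists_congr fun x => and_congr_right fun hx => ?_
    rw [radialExt_of_norm_eq_one hx, eq_comm]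
  rw [this]
  refine (isCompact_sphere 0 1).image_of_continuousOn fun x hx => ?_
  have hx0 : x ≠ 0 := by rintro rfl; simp at hx
  exact ((hρ.contDiffAt_radialExt hx0).continuousAt.smul continuousAt_id).continuousWithinAt

/-- The quotient of the second fundamental form by the support function attains its maximum on
the unit tangent bundle. -/
theorem exists_max_secondFF (hρ : IsRadialFunction 4 ρ) (hX : X ∈ hypersurface ρ)
    (ξ : tangent ρ X) (hξ : ‖ξ‖ = 1) :
    ∃ X₀ ∈ hypersurface ρ, ∃ ξ₀ : tangent ρ X₀, ‖ξ₀‖ = 1 ∧ ∀ Y ∈ hypersurface ρ,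
      ∀ η : tangent ρ Y, ‖η‖ = 1 →
        secondFF ρ Y η η / support ρ Y ≤ secondFF ρ X₀ ξ₀ ξ₀ / support ρ X₀ := by
  have hne : ∀ {Y}, Y ∈ hypersurface ρ → Y ≠ 0 := fun hY =>
    ne_zero_of_definingFun_eq_one (hρ.mem_hypersurface_iff.1 hY)
  have hN : ContinuousOn (normal ρ) (hypersurface ρ) := fun Y hY =>
    (hρ.contDiffAt_normal (hne hY)).continuousAt.continuousWithinAt
  have hDN : ContinuousOn (fderiv ℝ (normal ρ)) (hypersurface ρ) := fun Y hY =>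
    ((hρ.contDiffAt_normal (hne hY)).fderiv_right (m := 2)
      (by norm_num)).continuousAt.continuousWithinAt
  have hS : ContinuousOn (support ρ) (hypersurface ρ) := continuousOn_id.inner hN
  let B : Set (E n × E n) := hypersurface ρ ×ˢ Metric.sphere 0 1
  have hB : IsCompact B := hρ.isCompact_hypersurface.prod (isCompact_sphere 0 1)
  have hfst : Set.MapsTo Prod.fst B (hypersurface ρ) := fun P hP => hP.1
  have hN' : ContinuousOn (fun P : E n × E n => normal ρ P.1) B :=
    hN.comp continuousOn_fst hfst
  have hc : ContinuousOn (fun P : E n × E n => (⟪normal ρ P.1, P.2⟫ : ℝ)) B :=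
    hN'.inner continuousOn_snd
  -- The unit tangent bundle, realised as a compact subset of M × 𝕊ⁿ.
  let T : Set (E n × E n) := B ∩ (fun P : E n × E n => (⟪normal ρ P.1, P.2⟫ : ℝ)) ⁻¹' {0}
  have hT : IsCompact T := hB.of_isClosed_subset
    (hc.preimage_isClosed_of_isClosed hB.isClosed isClosed_singleton) Set.inter_subset_left
  have hmem : ∀ {Y}, Y ∈ hypersurface ρ → ∀ η : tangent ρ Y, ‖η‖ = 1 → (Y, (η : E n)) ∈ T := by
    intro Y hY η hη
    refine ⟨⟨hY, by simpa using hη⟩, ?_⟩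
    exact Submodule.mem_orthogonal_singleton_iff_inner_right.1 η.2
  have hf : ContinuousOn (fun P : E n × E n =>
      (⟪fderiv ℝ (normal ρ) P.1 P.2, P.2⟫ : ℝ) / support ρ P.1) T := by
    refine ContinuousOn.mono ?_ (Set.inter_subset_left : T ⊆ B)
    refine ContinuousOn.div ?_ (hS.comp continuousOn_fst hfst)
      fun P hP => (hρ.support_pos hP.1).ne'
    exact ((hDN.comp continuousOn_fst hfst).clm_apply continuousOn_snd).inner continuousOn_snd
  obtain ⟨⟨X₀, ξ₀⟩, hP, hmax⟩ := hT.exists_isMaxOn ⟨_, hmem hX ξ hξ⟩ hf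
  refine ⟨X₀, hP.1.1, ⟨ξ₀, Submodule.mem_orthogonal_singleton_iff_inner_right.2 hP.2⟩,
    by simpa using hP.1.2, fun Y hY η hη => hmax (hmem hY η hη)⟩

end IsRadialFunction

end

/-! ### The hypersurface as a graph over its tangent plane -/

section

variable {n : ℕ} {ρ : E n → ℝ} {X₀ : E n}

/-- An orthonormal frame of a hyperplane of `ℝ^{n+1}` together with a unit normal of it. -/
structure IsFrame (ν : E n) (e : Fin n → E n) : Prop where
  norm_normal : ‖ν‖ = 1
  orthonormal : Orthonormal ℝ e
  inner_normal : ∀ i, ⟪ν, e i⟫ = 0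
  expand : ∀ z, z = ⟪ν, z⟫ • ν + ∑ i, ⟪e i, z⟫ • e i

/-- Near `X₀`, at the point over `z`, the hypersurface is the graph of `-w` over the hyperplane with
frame `e` and normal `ν` through `X₀`. -/
structure IsGraphAt (ρ : E n → ℝ) (X₀ ν : E n) (e : Fin n → E n) (w : E n → ℝ) (z : E n) :
    Prop where
  mem : X₀ + z - w z • ν ∈ hypersurface ρ
  normal_eq : normal ρ (X₀ + z - w z • ν) = (√(1 + ∑ i, dirDeriv (e i) w z ^ 2))⁻¹ •
    (ν + ∑ i, dirDeriv (e i) w z • e i)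
  inner_fderiv_normal : ∀ i j, ⟪fderiv ℝ (normal ρ) (X₀ + z - w z • ν)
      (e i - dirDeriv (e i) w z • ν), e j - dirDeriv (e j) w z • ν⟫ =
    (√(1 + ∑ i, dirDeriv (e i) w z ^ 2))⁻¹ * dirDeriv (e i) (dirDeriv (e j) w) z

namespace IsFrame

variable {ν : E n} {e : Fin n → E n}

theorem inner_self (hF : IsFrame ν e) : ⟪ν, ν⟫ = 1 := by
  rw [real_inner_self_eq_norm_sq, hF.norm_normal, one_pow]

theorem inner_frame (hF : IsFrame ν e) (i j : Fin n) : ⟪e i, e j⟫ = if i = j then (1 : ℝ) else 0 :=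
  orthonormal_iff_ite.1 hF.orthonormal i j

theorem inner_normal' (hF : IsFrame ν e) (i : Fin n) : ⟪e i, ν⟫ = 0 := by
  rw [real_inner_comm, hF.inner_normal]

theorem inner_combination (hF : IsFrame ν e) (q : Fin n → ℝ) (j : Fin n) :
    ⟪∑ i, q i • e i, e j⟫ = q j := by
  simp [sum_inner, inner_smul_left, hF.inner_frame]

theorem inner_normal_combination (hF : IsFrame ν e) (q : Fin n → ℝ) :
    ⟪ν, ∑ i, q i • e i⟫ = 0 := by
  simp [inner_sum, inner_smul_right, hF.inner_normal]

theorem norm_add_combination (hF : IsFrame ν e) (q : Fin n → ℝ) :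
    ‖ν + ∑ i, q i • e i‖ = √(1 + ∑ i, q i ^ 2) := by
  rw [norm_eq_sqrt_real_inner]
  congr 1
  rw [inner_add_left, inner_add_right, inner_add_right, hF.inner_self, hF.inner_normal_combination,
    real_inner_comm, hF.inner_normal_combination, inner_sum]
  simp only [inner_smul_right, hF.inner_combination]
  simp [sq]

end IsFrame

/-- The linear automorphism `v ↦ v + (c - 1) ⟨ν, v⟩ ν`, scaling the direction of `ν` by `c`. -/
def scaleAlong (ν : E n) (hν : ‖ν‖ = 1) (c : ℝ) (hc : c ≠ 0) : E n ≃L[ℝ] E n :=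
  ContinuousLinearEquiv.equivOfInverse
    (ContinuousLinearMap.id ℝ (E n) + (c - 1) • (innerSL ℝ ν).smulRight ν)
    (ContinuousLinearMap.id ℝ (E n) + (c⁻¹ - 1) • (innerSL ℝ ν).smulRight ν)
    (fun v => by
      have : ⟪ν, ν⟫ = 1 := by rw [real_inner_self_eq_norm_sq, hν, one_pow]
      simp only [_root_.add_apply, ContinuousLinearMap.id_apply,
        _root_.smul_apply, ContinuousLinearMap.smulRight_apply, innerSL_apply_apply,
        inner_add_right, inner_smul_right, this]
      match_scalars
      · ring
      · field_simp
        ring)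
    (fun v => by
      have : ⟪ν, ν⟫ = 1 := by rw [real_inner_self_eq_norm_sq, hν, one_pow]
      simp only [_root_.add_apply, ContinuousLinearMap.id_apply,
        _root_.smul_apply, ContinuousLinearMap.smulRight_apply, innerSL_apply_apply,
        inner_add_right, inner_smul_right, this]
      match_scalars
      · ring
      · field_simp
        ring)

/-- The level sets of the defining function near `X₀` are graphs over the tangent plane. -/
theorem IsRadialFunction.exists_level_graph (hρ : IsRadialFunction 4 ρ)
    (hX₀ : X₀ ∈ hypersurface ρ) {e : Fin n → E n} (hF : IsFrame (normal ρ X₀) e) :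
    ∃ w : E n → ℝ, ContDiffAt ℝ 4 w 0 ∧ w 0 = 0 ∧ ∀ᶠ z in 𝓝 0,
      definingFun ρ (X₀ + z - ⟪normal ρ X₀, z⟫ • normal ρ X₀ - w z • normal ρ X₀) =
        1 + ⟪normal ρ X₀, z⟫ := by
  have hG1 := hρ.mem_hypersurface_iff.1 hX₀
  have h0 := ne_zero_of_definingFun_eq_one hG1
  set ν := normal ρ X₀ with hν
  set c := ‖gradient (definingFun ρ) X₀‖ with hc
  have hc0 : c ≠ 0 := norm_ne_zero_iff.2 (hρ.gradient_ne_zero h0)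
  have hgrad : gradient (definingFun ρ) X₀ = c • ν := by
    rw [hν, normal, smul_smul, mul_inv_cancel₀ hc0, one_smul]
  -- `Θ` keeps the tangential part of X - X₀ and replaces the normal part by the level minus 1. Its
  -- derivative at X₀ only rescales the normal direction by the length of the gradient, so it has a
  -- local inverse, and `w` is read off from the height of that inverse.
  let Θ : E n → E n := fun X => (X - X₀) - ⟪ν, X - X₀⟫ • ν + (definingFun ρ X - 1) • ν
  have hΘ0 : Θ X₀ = 0 := by simp [Θ, hG1]
  have hGd := hρ.contDiffAt_definingFun h0
  have hΘ : ContDiffAt ℝ 4 Θ X₀ := by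
    have h1 : ContDiffAt ℝ 4 (fun X : E n => X - X₀) X₀ := contDiffAt_id.sub contDiffAt_const
    exact (h1.sub ((contDiffAt_const.inner ℝ h1).smul contDiffAt_const)).add
      ((hGd.sub contDiffAt_const).smul contDiffAt_const)
  have hΘ' : HasFDerivAt Θ (scaleAlong ν hF.norm_normal c hc0 : E n →L[ℝ] E n) X₀ := by
    have h1 : HasFDerivAt (fun X : E n => X - X₀) (ContinuousLinearMap.id ℝ (E n)) X₀ :=
      (hasFDerivAt_id X₀).sub_const X₀
    have h2 : HasFDerivAt (fun X : E n => (⟪ν, X - X₀⟫ : ℝ)) (innerSL ℝ ν) X₀ :=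
      (innerSL ℝ ν).hasFDerivAt.comp X₀ h1
    have h3 := (hGd.differentiableAt (by norm_num)).hasFDerivAt.sub_const 1
    refine ((h1.sub (h2.smul_const ν)).add (h3.smul_const ν)).congr_fderiv ?_
    ext1 v
    have h4 : fderiv ℝ (definingFun ρ) X₀ v = c * ⟪ν, v⟫ := by
      rw [← inner_gradient_left, hgrad, inner_smul_left]; rfl
    simp only [_root_.add_apply, _root_.sub_apply,
      ContinuousLinearMap.id_apply, ContinuousLinearMap.smulRight_apply, innerSL_apply_apply, h4]
    change _ = v + (c - 1) • (⟪ν, v⟫ : ℝ) • ν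
    module
  let Y : E n → E n := hΘ.localInverse hΘ' (by norm_num)
  have hY : ContDiffAt ℝ 4 Y 0 := hΘ0 ▸ hΘ.to_localInverse hΘ' (by norm_num)
  have hY0 : Y 0 = X₀ := by
    have := hΘ.localInverse_apply_image hΘ' (by norm_num)
    rwa [hΘ0] at this
  have hinv : ∀ᶠ z in 𝓝 0, Θ (Y z) = z := by
    have := (hΘ.hasStrictFDerivAt' hΘ' (by norm_num)).eventually_right_inverse
    rw [hΘ0] at this
    exact this
  refine ⟨fun z => ⟪ν, X₀ - Y z⟫, contDiffAt_const.inner ℝ (contDiffAt_const.sub hY),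
    by simp [hY0], ?_⟩
  filter_upwards [hinv] with z hz
  have e1 : definingFun ρ (Y z) - 1 = ⟪ν, z⟫ := by
    have := congrArg (fun v : E n => (⟪ν, v⟫ : ℝ)) hz
    simp only [Θ, inner_add_right, inner_sub_right, inner_smul_right, hF.inner_self] at this
    linarith
  have e2 : X₀ + z - ⟪ν, z⟫ • ν - ⟪ν, X₀ - Y z⟫ • ν = Y z := by
    rw [← e1]
    nth_rewrite 1 [← hz]
    simp only [Θ, inner_sub_right]
    module
  rw [e2]
  linarith

/-- M is the slice ⟨ν,z⟩ = 0 of the family of level graphs. Having `w` defined on a full ambient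
neighbourhood permits ordinary Fréchet calculus; only its derivatives along the frame enter. -/
theorem IsRadialFunction.exists_graph (hρ : IsRadialFunction 4 ρ)
    (hX₀ : X₀ ∈ hypersurface ρ) {e : Fin n → E n} (hF : IsFrame (normal ρ X₀) e) :
    ∃ w : E n → ℝ, ContDiffAt ℝ 4 w 0 ∧ w 0 = 0 ∧ (∀ i, dirDeriv (e i) w 0 = 0) ∧
      ∀ᶠ z in 𝓝 0, ⟪normal ρ X₀, z⟫ = 0 → IsGraphAt ρ X₀ (normal ρ X₀) e w z := by
  obtain ⟨w, hw, hw0, hlev⟩ := hρ.exists_level_graph hX₀ hF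
  have h0 := ne_zero_of_definingFun_eq_one (hρ.mem_hypersurface_iff.1 hX₀)
  have hN0 := hρ.gradient_ne_zero h0
  set ν := normal ρ X₀ with hν
  let Y : E n → E n := fun z => X₀ + z - ⟪ν, z⟫ • ν - w z • ν
  have hY0 : Y 0 = X₀ := by simp [Y, hw0]
  have hYc : ContinuousAt Y 0 := by
    have := hw.continuousAt
    fun_prop
  have hwe := hw.eventually (by norm_num)
  have hYd : ∀ᶠ z in 𝓝 0, HasFDerivAt Y (ContinuousLinearMap.id ℝ (E n) -
      (innerSL ℝ ν).smulRight ν - (fderiv ℝ w z).smulRight ν) z := by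
    filter_upwards [hwe] with z hz
    have h2 : HasFDerivAt (fun X : E n => (⟪ν, X⟫ : ℝ)) (innerSL ℝ ν) z :=
      (innerSL ℝ ν).hasFDerivAt
    exact (((hasFDerivAt_id z).const_add X₀).sub (h2.smul_const ν)).sub
      ((hz.differentiableAt (by norm_num)).hasFDerivAt.smul_const ν)
  have happly : ∀ z i, (ContinuousLinearMap.id ℝ (E n) - (innerSL ℝ ν).smulRight ν -
      (fderiv ℝ w z).smulRight ν) (e i) = e i - dirDeriv (e i) w z • ν := by
    intro z i
    simp [hF.inner_normal, dirDeriv]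
  have hYne : ∀ᶠ z in 𝓝 0, Y z ≠ 0 :=
    hYc.eventually (by rw [hY0]; exact isOpen_ne.mem_nhds h0)
  -- Differentiating the level identity along e_i kills its right side, so the gradient is
  -- orthogonal to e_i - w_i ν and hence parallel to ν + ∑ w_i e_i.
  have htan : ∀ᶠ z in 𝓝 0, ∀ i,
      ⟪gradient (definingFun ρ) (Y z), e i⟫ =
        dirDeriv (e i) w z * ⟪gradient (definingFun ρ) (Y z), ν⟫ := by
    filter_upwards [hlev.eventually_nhds, hYd, hYne] with z hz hd hne i
    have h1 := ((hρ.contDiffAt_definingFun hne).differentiableAt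
      (by norm_num)).hasFDerivAt.comp z hd
    have h2 : HasFDerivAt (fun X : E n => 1 + (⟪ν, X⟫ : ℝ)) (innerSL ℝ ν) z :=
      (innerSL ℝ ν).hasFDerivAt.const_add 1
    have h3 := DFunLike.congr_fun (h1.unique (h2.congr_of_eventuallyEq hz)) (e i)
    rw [ContinuousLinearMap.comp_apply, happly, innerSL_apply_apply, hF.inner_normal,
      ← inner_gradient_left, inner_sub_right, inner_smul_right] at h3
    linarith
  have hpos : ∀ᶠ z in 𝓝 0, 0 < ⟪gradient (definingFun ρ) (Y z), ν⟫ := by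
    have hc : ContinuousAt (fun z => (⟪gradient (definingFun ρ) (Y z), ν⟫ : ℝ)) 0 := by
      refine ContinuousAt.inner ?_ continuousAt_const
      exact ContinuousAt.comp (f := Y) (g := gradient (definingFun ρ))
        (by rw [hY0]; exact (hρ.contDiffAt_gradient h0).continuousAt) hYc
    refine hc.eventually (lt_mem_nhds ?_)
    change 0 < (⟪gradient (definingFun ρ) (Y 0), ν⟫ : ℝ)
    rw [hY0, hν, normal, inner_smul_right, real_inner_self_eq_norm_sq]
    have := norm_pos_iff.2 hN0
    positivity
  have hnormal : ∀ᶠ z in 𝓝 0, normal ρ (Y z) =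
      (√(1 + ∑ i, dirDeriv (e i) w z ^ 2))⁻¹ • (ν + ∑ i, dirDeriv (e i) w z • e i) := by
    filter_upwards [htan, hpos] with z ht hp
    set p := gradient (definingFun ρ) (Y z) with hpdef
    have hp' : p = ⟪p, ν⟫ • (ν + ∑ i, dirDeriv (e i) w z • e i) := by
      conv_lhs => rw [hF.expand p]
      rw [smul_add, Finset.smul_sum, real_inner_comm]
      congr 1
      refine Finset.sum_congr rfl fun i _ => ?_
      rw [real_inner_comm, ht i, smul_smul, mul_comm]
    rw [normal, ← hpdef]
    have hnp : ‖p‖ = ⟪p, ν⟫ * √(1 + ∑ i, dirDeriv (e i) w z ^ 2) := by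
      rw [← hF.norm_add_combination]
      conv_lhs => rw [hp']
      rw [norm_smul, Real.norm_of_nonneg hp.le]
    rw [hnp]
    conv_lhs => rw [hp']
    rw [smul_smul, ← hp']
    congr 1
    field_simp
  have hq0 : ∀ i, dirDeriv (e i) w 0 = 0 := by
    intro i
    have h1 := htan.self_of_nhds i
    have h2 := hpos.self_of_nhds
    rw [hY0] at h1 h2
    have h3 : ⟪gradient (definingFun ρ) X₀, e i⟫ = 0 := by
      have := hF.inner_normal i
      rw [hν, normal, inner_smul_left] at this
      have hne := norm_ne_zero_iff.2 hN0
      simpa [hne] using this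
    rw [h3] at h1
    exact (mul_eq_zero.1 h1.symm).resolve_right h2.ne'
  refine ⟨w, hw, hw0, hq0, ?_⟩
  filter_upwards [hlev, hnormal.eventually_nhds, hYd, hYne, hwe] with z hz hNz hd hne hwz hzν
  have hYz : X₀ + z - w z • ν = Y z := by simp [Y, hzν]
  refine ⟨?_, ?_, fun i j => ?_⟩
  · rw [hYz, hρ.mem_hypersurface_iff]
    change definingFun ρ (Y z) = _ at hz
    rw [hz, hzν, add_zero]
  · rw [hYz]; exact hNz.self_of_nhds
  · rw [hYz]
    have h1 := (((hρ.contDiffAt_normal hne).differentiableAt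
      (by norm_num)).hasFDerivAt.comp z hd)
    have hq := ((contDiffAt_dirDeriv hwz (k := 3) (by norm_num) (e j)).differentiableAt
      (by norm_num)).hasFDerivAt
    have h2 := (hq.smul_const ν).const_sub (e j)
    have h3 := h1.inner ℝ h2
    -- Differentiating the orthogonality of N and e_j - w_j ν moves the derivative from N to w_j:
    -- the second fundamental form is w_ij ⟨N,ν⟩.
    have hzero : (fun y => (⟪(normal ρ ∘ Y) y, e j - dirDeriv (e j) w y • ν⟫ : ℝ)) =ᶠ[𝓝 z]
        fun _ => 0 := by
      filter_upwards [hNz] with y hy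
      simp only [Function.comp_apply, hy, inner_smul_left, inner_add_left, inner_sub_right,
        inner_smul_right, hF.inner_normal, hF.inner_self, hF.inner_combination]
      rw [real_inner_comm, hF.inner_normal_combination]
      simp only [conj_trivial]
      ring
    have h4 := DFunLike.congr_fun (h3.unique
      ((hasFDerivAt_const (0 : ℝ) z).congr_of_eventuallyEq hzero)) (e i)
    have hs : ⟪normal ρ (Y z), ν⟫ = (√(1 + ∑ i, dirDeriv (e i) w z ^ 2))⁻¹ := by
      rw [hNz.self_of_nhds, inner_smul_left, inner_add_left, hF.inner_self, real_inner_comm ν,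
        hF.inner_normal_combination]
      simp
    simp only [ContinuousLinearMap.comp_apply, ContinuousLinearMap.prod_apply,
      fderivInnerCLM_apply, _root_.neg_apply, ContinuousLinearMap.smulRight_apply,
      happly, _root_.zero_apply, Function.comp_apply, inner_neg_right,
      inner_smul_right, hs] at h4
    change _ = _ * fderiv ℝ (dirDeriv (e j) w) z (e i)
    linarith

end

/-! ### Symmetric functions of the curvatures, and σ₂ of a graph -/

section

variable {n : ℕ} {ρ : E n → ℝ} {X X₀ : E n}

theorem two_mul_esymm_two (s : Multiset ℝ) :
    2 * s.esymm 2 = s.sum ^ 2 - (s.map (· ^ 2)).sum := by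
  induction s using Multiset.induction_on with
  | empty => simp [Multiset.esymm, Multiset.powersetCard_zero_right]
  | cons a s ih =>
    have h : (a ::ₘ s).esymm 2 = s.esymm 2 + a * s.sum := by
      have h1 : (s.map fun x => a * x).sum = a * s.sum := by
        simpa using s.sum_map_mul_left (a := a) (f := id)
      simp [Multiset.esymm, Multiset.powersetCard_cons, Multiset.powersetCard_one, h1]
    rw [h, mul_add, ih]
    simp
    ring

theorem esymm_one_eq_sum (s : Multiset ℝ) : s.esymm 1 = s.sum := by
  simp [Multiset.esymm, Multiset.powersetCard_one]

section Symmetric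

variable {V : Type*} [NormedAddCommGroup V] [InnerProductSpace ℝ V] [FiniteDimensional ℝ V]
  {S : V →ₗ[ℝ] V}

theorem sum_roots_charpoly_of_isSymmetric (hS : S.IsSymmetric) :
    S.charpoly.roots.sum = LinearMap.trace ℝ V S := by
  rw [hS.roots_charpoly_eq_eigenvalues rfl, hS.trace_eq_sum_eigenvalues rfl]
  rfl

/-- Traces can be computed in any basis, which makes σ₂ accessible in the non-orthonormal basis e_i
- w_i ν of a graph. -/
theorem two_mul_esymm_two_roots_charpoly (hS : S.IsSymmetric) :
    2 * S.charpoly.roots.esymm 2 =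
      LinearMap.trace ℝ V S ^ 2 - LinearMap.trace ℝ V (S ∘ₗ S) := by
  rw [two_mul_esymm_two, sum_roots_charpoly_of_isSymmetric hS,
    LinearMap.trace_eq_sum_inner (S ∘ₗ S) (hS.eigenvectorBasis rfl),
    hS.roots_charpoly_eq_eigenvalues rfl, Multiset.map_map]
  congr 1
  refine Finset.sum_congr rfl fun i _ => ?_
  simp [inner_smul_right, sq]

end Symmetric

theorem finrank_tangent (h : ‖normal ρ X‖ = 1) : Module.finrank ℝ (tangent ρ X) = n := by
  have : Fact (Module.finrank ℝ (E n) = n + 1) := ⟨by simp [E]⟩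
  exact Submodule.finrank_orthogonal_span_singleton (norm_ne_zero_iff.1 (by rw [h]; norm_num))

theorem mem_tangent_iff {v : E n} : v ∈ tangent ρ X ↔ ⟪normal ρ X, v⟫ = 0 :=
  Submodule.mem_orthogonal_singleton_iff_inner_right

theorem isFrame_of_orthonormalBasis (h : ‖normal ρ X‖ = 1)
    (b : OrthonormalBasis (Fin n) ℝ (tangent ρ X)) :
    IsFrame (normal ρ X) (fun i => (b i : E n)) where
  norm_normal := h
  orthonormal := b.orthonormal.comp_linearIsometry (tangent ρ X).subtypeₗᵢ
  inner_normal i := mem_tangent_iff.1 (b i).2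
  expand z := by
    have hself : ⟪normal ρ X, normal ρ X⟫ = 1 := by
      rw [real_inner_self_eq_norm_sq, h, one_pow]
    let z' : tangent ρ X := ⟨z - ⟪normal ρ X, z⟫ • normal ρ X, mem_tangent_iff.2 (by
      rw [inner_sub_right, inner_smul_right, hself, mul_one, sub_self])⟩
    have h1 := congrArg (Subtype.val) (b.sum_repr' z')
    have h2 : ∀ i, ⟪b i, z'⟫ = ⟪(b i : E n), z⟫ := fun i => by
      have := mem_tangent_iff.1 (b i).2
      rw [Submodule.coe_inner, inner_sub_right, inner_smul_right, real_inner_comm (normal ρ X),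
        this, mul_zero, sub_zero]
    rw [← sub_eq_iff_eq_add']
    change _ = (z' : E n) at h1
    rw [Submodule.coe_sum] at h1
    simp only [Submodule.coe_smul, h2] at h1
    exact h1.symm

namespace IsRadialFunction

/-- At the base point of the graph the second fundamental form is the Hessian of `w`, so this is the
symmetry of second derivatives. -/
theorem isSymmetric_shapeOperator (hρ : IsRadialFunction 4 ρ) (hX : X ∈ hypersurface ρ) :
    (shapeOperator ρ X).IsSymmetric := by
  have hN := hρ.norm_normal (ne_zero_of_definingFun_eq_one (hρ.mem_hypersurface_iff.1 hX))
  let b : OrthonormalBasis (Fin n) ℝ (tangent ρ X) :=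
    (stdOrthonormalBasis ℝ _).reindex (finCongr (finrank_tangent hN))
  obtain ⟨w, hw, hw0, hq, hgr⟩ := hρ.exists_graph hX (isFrame_of_orthonormalBasis hN b)
  have h0 := (hgr.self_of_nhds (by simp)).inner_fderiv_normal
  have key : ∀ i j, ⟪shapeOperator ρ X (b i), b j⟫ = ⟪b i, shapeOperator ρ X (b j)⟫ := by
    intro i j
    have h1 := h0 i j
    have h2 := h0 j i
    rw [dirDeriv_comm (hw.of_le (by norm_num))] at h2
    simp only [hw0, hq, zero_smul, add_zero, sub_zero] at h1 h2
    rw [real_inner_comm (shapeOperator ρ X (b j)), inner_shapeOperator, inner_shapeOperator,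
      secondFF, secondFF, h1, h2]
  intro x y
  obtain ⟨c, hc⟩ : ∃ c : Fin n → ℝ, x = ∑ i, c i • b i := ⟨_, (b.sum_repr x).symm⟩
  obtain ⟨d, hd⟩ : ∃ d : Fin n → ℝ, y = ∑ i, d i • b i := ⟨_, (b.sum_repr y).symm⟩
  rw [hc, hd]
  simp only [map_sum, map_smul, sum_inner, inner_sum, inner_smul_left, inner_smul_right, key]

theorem sigma_one_eq (hρ : IsRadialFunction 4 ρ) (hX : X ∈ hypersurface ρ) :
    sigma 1 ρ X = LinearMap.trace ℝ _ (shapeOperator ρ X) := by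
  rw [sigma, esymm_one_eq_sum, principalCurvatures,
    sum_roots_charpoly_of_isSymmetric (hρ.isSymmetric_shapeOperator hX)]

theorem two_mul_sigma_two_eq (hρ : IsRadialFunction 4 ρ) (hX : X ∈ hypersurface ρ) :
    2 * sigma 2 ρ X = LinearMap.trace ℝ _ (shapeOperator ρ X) ^ 2 -
      LinearMap.trace ℝ _ (shapeOperator ρ X ∘ₗ shapeOperator ρ X) :=
  two_mul_esymm_two_roots_charpoly (hρ.isSymmetric_shapeOperator hX)

end IsRadialFunction

/-- The numerator of `2 σ₂` of the graph whose function has gradient `q` and Hessian `W`. -/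
def hessianSigma (W : Fin n → Fin n → ℝ) (q : Fin n → ℝ) : ℝ :=
  (1 + ∑ i, q i ^ 2) * ((∑ i, W i i) ^ 2 - ∑ i, ∑ j, W i j ^ 2) -
    2 * ((∑ i, W i i) * ∑ i, ∑ j, W i j * (q i * q j)) + 2 * ∑ i, (∑ j, W i j * q j) ^ 2

/-- The traces of `W` and `W²`, where the index is raised with the inverse of the metric
`δ_{ij} + q_i q_j`. -/
theorem raised_trace_identity {W : Fin n → Fin n → ℝ} (hW : ∀ i j, W i j = W j i) (q : Fin n → ℝ)
    {s D : ℝ} (hD : D = 1 + ∑ i, q i ^ 2) (hs : s ^ 2 * D = 1) {A : Fin n → Fin n → ℝ}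
    (hA : ∀ i j, A i j + q i * ∑ l, q l * A l j = s * W i j) :
    D ^ 2 * ((∑ i, A i i) ^ 2 - ∑ i, ∑ j, A i j * A j i) = hessianSigma W q := by
  have hD0 : D ≠ 0 := by rintro rfl; simp at hs
  set p : Fin n → ℝ := fun j => ∑ l, W j l * q l with hp
  have h1 : ∀ j, D * ∑ l, q l * A l j = s * p j := by
    intro j
    have : ∑ l, q l * (A l j + q l * ∑ k, q k * A k j) = ∑ l, q l * (s * W l j) :=
      Finset.sum_congr rfl fun l _ => by rw [hA]
    rw [hp, hD]
    simp only [mul_add, Finset.sum_add_distrib, ← mul_assoc, ← sq, ← Finset.sum_mul] at this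
    rw [add_mul, one_mul, this, Finset.mul_sum]
    exact Finset.sum_congr rfl fun l _ => by rw [hW j l]; ring
  -- The Sherman–Morrison inverse of the metric δ_ij + q_i q_j, multiplied by D to avoid division.
  have h2 : ∀ i j, D * A i j = s * (D * W i j - q i * p j) := by
    intro i j
    have := congrArg (D * ·) (hA i j)
    simp only [mul_add] at this
    rw [mul_left_comm D (q i), h1] at this
    linarith
  have hpq : ∑ i, ∑ j, W i j * (q i * q j) = ∑ i, q i * p i := by
    refine Finset.sum_congr rfl fun i _ => ?_
    rw [hp, Finset.mul_sum]
    exact Finset.sum_congr rfl fun j _ => by ring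
  have ht : D * ∑ i, A i i = s * (D * ∑ i, W i i - ∑ i, q i * p i) := by
    rw [Finset.mul_sum, Finset.mul_sum, ← Finset.sum_sub_distrib, Finset.mul_sum]
    exact Finset.sum_congr rfl fun i _ => h2 i i
  have hpp : ∑ i, ∑ j, W i j * (q j * p i) = ∑ i, p i ^ 2 := by
    refine Finset.sum_congr rfl fun i _ => ?_
    rw [sq]
    conv_rhs => rw [hp]
    rw [Finset.sum_mul]
    exact Finset.sum_congr rfl fun j _ => by ring
  have hpp' : ∑ i, ∑ j, W i j * (q i * p j) = ∑ i, p i ^ 2 := by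
    rw [Finset.sum_comm, ← hpp]
    exact Finset.sum_congr rfl fun i _ => Finset.sum_congr rfl fun j _ => by rw [hW]
  have hsq : D ^ 2 * ∑ i, ∑ j, A i j * A j i =
      s ^ 2 * (D ^ 2 * ∑ i, ∑ j, W i j ^ 2 - 2 * D * ∑ i, p i ^ 2 + (∑ i, q i * p i) ^ 2) := by
    have h3 : ∀ i j, D ^ 2 * (A i j * A j i) = s ^ 2 * (D ^ 2 * W i j ^ 2 -
        D * (W i j * (q j * p i)) - D * (W i j * (q i * p j)) + (q i * p i) * (q j * p j)) := by
      intro i j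
      calc D ^ 2 * (A i j * A j i) = (D * A i j) * (D * A j i) := by ring
        _ = _ := by rw [h2, h2, hW j i]; ring
    rw [Finset.mul_sum]
    simp only [Finset.mul_sum, h3]
    simp only [← Finset.mul_sum, Finset.sum_add_distrib, Finset.sum_sub_distrib, hpp, hpp',
      ← Finset.sum_mul]
    ring
  -- The squares (∑ q_i p_i)² from the two traces cancel. The factor s²D = 1 then splits off,
  -- leaving a polynomial in `W` and `q`.
  have hexp : D * (D ^ 2 * ((∑ i, A i i) ^ 2 - ∑ i, ∑ j, A i j * A j i)) =
      D * hessianSigma W q := by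
    have : D ^ 2 * ((∑ i, A i i) ^ 2 - ∑ i, ∑ j, A i j * A j i) =
        (D * ∑ i, A i i) ^ 2 - D ^ 2 * ∑ i, ∑ j, A i j * A j i := by ring
    rw [this, ht, hsq, hessianSigma, ← hD, hpq]
    change _ = D * (D * _ - _ + 2 * ∑ i, p i ^ 2)
    linear_combination (D * ((∑ i, W i i) ^ 2 - ∑ i, ∑ j, W i j ^ 2) -
      2 * ((∑ i, W i i) * ∑ i, q i * p i) + 2 * ∑ i, p i ^ 2) * D * hs
  exact mul_left_cancel₀ hD0 hexp

theorem IsGraphAt.sigma_two_eq (hρ : IsRadialFunction 4 ρ) {ν : E n} {e : Fin n → E n}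
    (hF : IsFrame ν e) {w : E n → ℝ} {z : E n} (hw : ContDiffAt ℝ 2 w z)
    (h : IsGraphAt ρ X₀ ν e w z) :
    (1 + ∑ i, dirDeriv (e i) w z ^ 2) ^ 2 * (2 * sigma 2 ρ (X₀ + z - w z • ν)) =
      hessianSigma (fun i j => dirDeriv (e i) (dirDeriv (e j) w) z)
        (fun i => dirDeriv (e i) w z) := by
  set Y := X₀ + z - w z • ν with hY
  set q : Fin n → ℝ := fun i => dirDeriv (e i) w z with hq
  set D := 1 + ∑ i, q i ^ 2 with hD
  have hDpos : 0 < D := by positivity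
  set s := (√D)⁻¹ with hs
  have hs0 : 0 < s := inv_pos.2 (Real.sqrt_pos.2 hDpos)
  have hsD : s ^ 2 * D = 1 := by
    rw [hs, inv_pow, Real.sq_sqrt hDpos.le, inv_mul_cancel₀ hDpos.ne']
  have hN : normal ρ Y = s • (ν + ∑ i, q i • e i) := h.normal_eq
  have htan : ∀ v : E n, v ∈ tangent ρ Y ↔ ⟪ν, v⟫ = -∑ i, q i * ⟪e i, v⟫ := by
    intro v
    rw [mem_tangent_iff, hN, inner_smul_left, inner_add_left, sum_inner]
    simp only [inner_smul_left, conj_trivial, mul_eq_zero, hs0.ne', false_or]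
    rw [add_eq_zero_iff_eq_neg]
  have hbν : ∀ i, ⟪ν, e i - q i • ν⟫ = -q i := fun i => by
    rw [inner_sub_right, inner_smul_right, hF.inner_normal, hF.inner_self]; ring
  have hbe : ∀ i j, ⟪e i, e j - q j • ν⟫ = if i = j then (1 : ℝ) else 0 := fun i j => by
    rw [inner_sub_right, inner_smul_right, hF.inner_normal', hF.inner_frame]; ring
  have hbt : ∀ i, e i - q i • ν ∈ tangent ρ Y := fun i => by
    rw [htan, hbν]; simp [hbe]
  -- The basis e_i - q_i ν of the tangent space. Projecting along ν recovers the coordinates, which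
  -- are therefore plain inner products with the e_i.
  let β : Module.Basis (Fin n) ℝ (tangent ρ Y) := Module.Basis.ofEquivFun
    { toFun := fun v i => ⟪e i, (v : E n)⟫
      map_add' := fun v v' => funext fun i => by simp [inner_add_right]
      map_smul' := fun c v => funext fun i => by simp [inner_smul_right]
      invFun := fun c => ∑ i, c i • (⟨e i - q i • ν, hbt i⟩ : tangent ρ Y)
      left_inv := fun v => by
        apply Subtype.ext
        have h1 := (htan v).1 v.2
        have h2 := hF.expand (v : E n)
        rw [h1] at h2
        simp only [Submodule.coe_sum, Submodule.coe_smul, smul_sub, Finset.sum_sub_distrib]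
        conv_rhs => rw [h2]
        simp only [smul_smul, ← Finset.sum_smul, neg_smul, mul_comm (q _)]
        abel
      right_inv := fun c => funext fun i => by
        simp [inner_sum, inner_smul_right, hbe] }
  have hβ : ∀ i, (β i : E n) = e i - q i • ν := fun i => by
    simp [β, Module.Basis.coe_ofEquivFun, Pi.single_apply, ite_smul]
  have hrepr : ∀ (v : tangent ρ Y) i, β.repr v i = ⟪e i, (v : E n)⟫ := fun v i => by
    rw [← Module.Basis.equivFun_apply]; simp [β]
  set S := shapeOperator ρ Y with hS
  set A : Matrix (Fin n) (Fin n) ℝ := LinearMap.toMatrix β β S with hAdef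
  have hAij : ∀ i j, A i j = ⟪e i, (S (β j) : E n)⟫ := fun i j => by
    rw [hAdef, LinearMap.toMatrix_apply, hrepr]
  have hsym : ∀ i j, dirDeriv (e i) (dirDeriv (e j) w) z = dirDeriv (e j) (dirDeriv (e i) w) z :=
    fun i j => dirDeriv_comm hw _ _
  have hA : ∀ i j, A i j + q i * ∑ l, q l * A l j =
      s * dirDeriv (e i) (dirDeriv (e j) w) z := by
    intro i j
    have h1 := h.inner_fderiv_normal j i
    rw [← hY] at h1
    have h2 : ⟪S (β j), β i⟫ = s * dirDeriv (e j) (dirDeriv (e i) w) z := by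
      rw [hS, inner_shapeOperator, secondFF, hβ, hβ]
      exact h1
    rw [hsym, ← h2, Submodule.coe_inner, hβ, inner_sub_right, inner_smul_right,
      real_inner_comm _ (S (β j) : E n), real_inner_comm _ (S (β j) : E n), (htan _).1 (S (β j)).2]
    simp only [hAij]
    ring
  rw [hρ.two_mul_sigma_two_eq h.mem, ← hS, LinearMap.trace_eq_matrix_trace ℝ β,
    LinearMap.trace_eq_matrix_trace ℝ β, LinearMap.toMatrix_comp β β β, ← hAdef]
  rw [← raised_trace_identity hsym q hD hsD hA]
  simp [Matrix.trace, Matrix.mul_apply]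

theorem IsGraphAt.support_eq {ν : E n} {e : Fin n → E n}
    (hF : IsFrame ν e) {w : E n → ℝ} {z : E n} (hz : ⟪ν, z⟫ = 0)
    (h : IsGraphAt ρ X₀ ν e w z) :
    support ρ (X₀ + z - w z • ν) = (√(1 + ∑ i, dirDeriv (e i) w z ^ 2))⁻¹ *
      (⟪X₀, ν⟫ + ∑ i, (⟪X₀, e i⟫ + ⟪z, e i⟫) * dirDeriv (e i) w z - w z) := by
  rw [support, h.normal_eq, inner_smul_right, inner_add_right, inner_sum]
  congr 1
  simp only [inner_smul_right, inner_sub_left, inner_add_left, inner_smul_left, hF.inner_self,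
    hF.inner_normal, conj_trivial, mul_zero, sub_zero, mul_one, real_inner_comm ν z, hz, add_zero,
    mul_comm (dirDeriv _ _ _)]
  ring

end

/-! ### Quantitative concavity of σ₂ and the algebra at a maximum point -/

section

variable {n : ℕ}

/-- On the orthogonal complement of a vector `κ` with `(∑ κ)² - |κ|² = q > 0` the Lorentzian form
`|b|² - (∑ b)²` controls each coordinate. -/
theorem lorentz_orthogonal_ge {κ b : Fin n → ℝ} {q : ℝ} (hq : 0 < q)
    (hκ : (∑ i, κ i) ^ 2 - ∑ i, κ i ^ 2 = q) (hb : (∑ i, κ i) * ∑ i, b i = ∑ i, κ i * b i)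
    (k : Fin n) : q / (κ k ^ 2 + q) * b k ^ 2 ≤ ∑ i, b i ^ 2 - (∑ i, b i) ^ 2 := by
  have hden : 0 < κ k ^ 2 + q := by positivity
  -- Weighted Cauchy–Schwarz for ∑ κ_i b_i: the whole surplus q is added to the k-th weight, turning
  -- |κ|² into (∑ κ)², and the k-th b-weight is reduced so that the product stays κ_k² b_k².
  have hcs := Finset.sum_sq_le_sum_mul_sum_of_sq_le_mul Finset.univ
    (r := fun i => κ i * b i) (f := fun i => κ i ^ 2 + if i = k then q else 0)
    (g := fun i => b i ^ 2 - if i = k then q / (κ k ^ 2 + q) * b k ^ 2 else 0)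
    (fun i _ => by split_ifs <;> positivity)
    (fun i _ => by
      split_ifs with h
      · subst h
        have : b i ^ 2 - q / (κ i ^ 2 + q) * b i ^ 2 = κ i ^ 2 * b i ^ 2 / (κ i ^ 2 + q) := by
          field_simp; ring
        rw [this]; positivity
      · rw [sub_zero]; positivity)
    (fun i _ => le_of_eq (by
      split_ifs with h
      · subst h; field_simp; ring
      · ring))
  simp only [Finset.sum_add_distrib, Finset.sum_sub_distrib, Finset.sum_ite_eq',
    Finset.mem_univ, if_true] at hcs
  have hsum : ∑ i, κ i ^ 2 + q = (∑ i, κ i) ^ 2 := by linarith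
  rw [← hb, hsum, mul_pow] at hcs
  have hpos : 0 < (∑ i, κ i) ^ 2 := by
    rw [← hsum]
    exact add_pos_of_nonneg_of_pos (Finset.sum_nonneg fun i _ => sq_nonneg _) hq
  linarith [le_of_mul_le_mul_left hcs hpos]

/-- A quantitative form of the concavity of `σ₂^{1/2}`. -/
theorem neg_lorentz_ge {κ t : Fin n → ℝ} {f g : ℝ} (hf : 0 < f)
    (hκ : (∑ i, κ i) ^ 2 - ∑ i, κ i ^ 2 = 2 * f) (hg : ∑ i, ((∑ j, κ j) - κ i) * t i = g)
    (k : Fin n) :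
    2 * f / (κ k ^ 2 + 2 * f) * (t k - g / (2 * f) * κ k) ^ 2 - g ^ 2 / (2 * f) ≤
      ∑ i, t i ^ 2 - (∑ i, t i) ^ 2 := by
  -- With this `c`, the vector t - cκ is orthogonal to κ for the Lorentzian form, so the form splits
  -- into the κ-part -g²/(2f) and a part bounded by `lorentz_orthogonal_ge`.
  set c := g / (2 * f) with hc
  have hcg : g = c * (2 * f) := by rw [hc]; field_simp
  have hg' : (∑ i, κ i) * ∑ i, t i - ∑ i, κ i * t i = g := by
    rw [← hg, Finset.mul_sum, ← Finset.sum_sub_distrib]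
    exact Finset.sum_congr rfl fun i _ => by ring
  have hs1 : ∑ i, (t i - c * κ i) = ∑ i, t i - c * ∑ i, κ i := by
    rw [Finset.sum_sub_distrib, Finset.mul_sum]
  have hs2 : ∑ i, κ i * (t i - c * κ i) = ∑ i, κ i * t i - c * ∑ i, κ i ^ 2 := by
    rw [Finset.mul_sum, ← Finset.sum_sub_distrib]
    exact Finset.sum_congr rfl fun i _ => by ring
  have hs3 : ∑ i, (t i - c * κ i) ^ 2 =
      ∑ i, t i ^ 2 - 2 * c * ∑ i, κ i * t i + c ^ 2 * ∑ i, κ i ^ 2 := by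
    rw [Finset.mul_sum, Finset.mul_sum, ← Finset.sum_sub_distrib, ← Finset.sum_add_distrib]
    exact Finset.sum_congr rfl fun i _ => by ring
  have h := lorentz_orthogonal_ge (b := fun i => t i - c * κ i) (by positivity) hκ
    (by simp only [hs1, hs2]; linear_combination hg' - c * hκ + hcg) k
  simp only [hs1, hs3] at h
  have hgg : g ^ 2 / (2 * f) = c * g := by rw [hc]; ring
  rw [hgg]
  have hfinal : ∑ i, t i ^ 2 - 2 * c * ∑ i, κ i * t i + c ^ 2 * ∑ i, κ i ^ 2 -
      (∑ i, t i - c * ∑ i, κ i) ^ 2 = ∑ i, t i ^ 2 - (∑ i, t i) ^ 2 + c * g := by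
    linear_combination 2 * c * hg' - c ^ 2 * hκ + c * hcg
  linarith

/-- For large L the prefactor times L² is close to 2f, and 2(1-α/2)² - α²/2 = 2 - 2α gives the
leading coefficient. The correction to the prefactor costs only terms without a factor L. -/
theorem concavity_gain {L f y e α : ℝ} (hf : 0 < f) :
    f * L ^ 2 * y ^ 2 * (2 - 2 * α) - 2 * L * y * e - 2 * f ^ 2 * y ^ 2 * (2 - α) ^ 2 - e ^ 2 / f ≤
      2 * f / (L ^ 2 + 2 * f) * (L ^ 2 * y - (e + α * f * L * y) / (2 * f) * L) ^ 2 -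
        (e + α * f * L * y) ^ 2 / (2 * f) := by
  have hden : 0 < L ^ 2 + 2 * f := by positivity
  set b := L * y * (1 - α / 2) - e / (2 * f) with hb
  have h1 : L ^ 2 * y - (e + α * f * L * y) / (2 * f) * L = L * b := by
    rw [hb]; field_simp; ring
  have h2 : 2 * f / (L ^ 2 + 2 * f) * (L * b) ^ 2 =
      2 * f * b ^ 2 - 4 * f ^ 2 * b ^ 2 / (L ^ 2 + 2 * f) := by
    field_simp; ring
  have h3 : b ^ 2 ≤ 2 * (L * y * (1 - α / 2)) ^ 2 + 2 * (e / (2 * f)) ^ 2 := by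
    rw [hb]; nlinarith [sq_nonneg (L * y * (1 - α / 2) + e / (2 * f))]
  have h4 : 4 * f ^ 2 * b ^ 2 / (L ^ 2 + 2 * f) ≤ 2 * f ^ 2 * y ^ 2 * (2 - α) ^ 2 + e ^ 2 / f := by
    rw [div_le_iff₀ hden]
    have h5 : 4 * f ^ 2 * b ^ 2 ≤ 2 * f ^ 2 * y ^ 2 * (2 - α) ^ 2 * L ^ 2 + 2 * e ^ 2 := by
      calc 4 * f ^ 2 * b ^ 2
          ≤ 4 * f ^ 2 * (2 * (L * y * (1 - α / 2)) ^ 2 + 2 * (e / (2 * f)) ^ 2) := by gcongr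
        _ = _ := by field_simp; ring
    have h6 : e ^ 2 / f * (2 * f) = 2 * e ^ 2 := by field_simp
    have h7 : 0 ≤ e ^ 2 / f * L ^ 2 := by positivity
    have h8 : 0 ≤ 2 * f ^ 2 * y ^ 2 * (2 - α) ^ 2 * (2 * f) := by positivity
    nlinarith
  rw [h1, h2]
  have h9 : 2 * f * b ^ 2 - (e + α * f * L * y) ^ 2 / (2 * f) =
      f * L ^ 2 * y ^ 2 * (2 - 2 * α) - 2 * L * y * e := by
    rw [hb]; field_simp; ring
  linarith

/-- The differential inequality at a maximum point of the quotient of the largest principal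
curvature `κ k` by the support function `u`. Here `T` and `Q` are the third derivatives and the
fourth derivatives `∂_k ∂_k ∂_i ∂_i` of the graph function, and `ψ`, `Ψ` stem from the first and
second derivatives of the prescribed function. -/
theorem curvature_inequality {κ x ψ Q : Fin n → ℝ} {T : Fin n → Fin n → Fin n → ℝ}
    {u f α Ψ : ℝ} (k : Fin n) (hf : 0 < f)
    (hκ : (∑ i, κ i) ^ 2 - ∑ i, κ i ^ 2 = 2 * f) (hκpos : 0 < ∑ i, κ i)
    (h1 : ∀ i, T k k i = κ k / u * (κ i * x i))
    (h2 : ∀ i, Q i ≤ 2 * κ k ^ 3 * (if i = k then 1 else 0) +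
      κ k / u * (∑ l, T i i l * x l + κ i))
    (h3 : ∀ l, ∑ i, ((∑ j, κ j) - κ i) * T i i l = ψ l + α * f / u * (κ l * x l))
    (h4 : ∑ i, ((∑ j, κ j) - κ i) * Q i + (∑ i, T i i k) ^ 2 - ∑ i, ∑ j, T i j k ^ 2 +
        2 * κ k ^ 2 * (f - κ k * ((∑ j, κ j) - κ k)) =
      (4 - α) * κ k ^ 2 * f + Ψ + 2 * α / u * ψ k * (κ k * x k) +
        α * f / u * (∑ l, T k k l * x l + κ k) + α * (α - 1) * f * (κ k * x k / u) ^ 2) :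
    f * κ k ^ 2 * (2 - α) * (1 + (1 - α) * (x k / u) ^ 2) ≤
      κ k / u * (∑ l, ψ l * x l + 2 * f) - Ψ - 2 * α * ψ k * κ k * (x k / u) - α * f * κ k / u +
        2 * κ k * (x k / u) * ψ k + 2 * f ^ 2 * (x k / u) ^ 2 * (2 - α) ^ 2 + ψ k ^ 2 / f := by
  have hF : ∀ i, 0 ≤ (∑ j, κ j) - κ i := by
    intro i
    have h5 : κ i ^ 2 ≤ ∑ j, κ j ^ 2 :=
      Finset.single_le_sum (f := fun j => κ j ^ 2) (fun j _ => sq_nonneg _) (Finset.mem_univ i)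
    have h6 : κ i ^ 2 ≤ (∑ j, κ j) ^ 2 := by linarith
    linarith [(abs_le_of_sq_le_sq' h6 hκpos.le).2]
  have hsumQ : ∑ i, ((∑ j, κ j) - κ i) * Q i ≤ 2 * κ k ^ 3 * ((∑ j, κ j) - κ k) +
      κ k / u * (∑ l, ψ l * x l + α * f / u * ∑ l, κ l * x l ^ 2 + 2 * f) := by
    calc ∑ i, ((∑ j, κ j) - κ i) * Q i
        ≤ ∑ i, ((∑ j, κ j) - κ i) * (2 * κ k ^ 3 * (if i = k then 1 else 0) +
            κ k / u * (∑ l, T i i l * x l + κ i)) :=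
          Finset.sum_le_sum fun i _ => mul_le_mul_of_nonneg_left (h2 i) (hF i)
      _ = 2 * κ k ^ 3 * ((∑ j, κ j) - κ k) + κ k / u *
            (∑ l, (∑ i, ((∑ j, κ j) - κ i) * T i i l) * x l +
              ∑ i, ((∑ j, κ j) - κ i) * κ i) := by
          simp only [mul_add, Finset.sum_add_distrib, mul_ite, mul_one, mul_zero,
            Finset.sum_ite_eq', Finset.mem_univ, if_true, Finset.sum_mul, Finset.mul_sum]
          rw [Finset.sum_comm, mul_comm]
          congr 2
          · exact Finset.sum_congr rfl fun i _ => Finset.sum_congr rfl fun j _ => by ring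
          · exact Finset.sum_congr rfl fun i _ => by ring
      _ = _ := by
          simp only [h3, add_mul, Finset.sum_add_distrib]
          have h5 : ∑ i, ((∑ j, κ j) - κ i) * κ i = 2 * f := by
            simp only [sub_mul, Finset.sum_sub_distrib, ← Finset.mul_sum, ← sq]
            exact hκ
          rw [h5, Finset.mul_sum (a := α * f / u)]
          congr 3
          congr 1
          exact Finset.sum_congr rfl fun i _ => by ring
  have hkk : ∑ l, T k k l * x l = κ k / u * ∑ l, κ l * x l ^ 2 := by
    rw [Finset.mul_sum]
    exact Finset.sum_congr rfl fun i _ => by rw [h1]; ring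
  -- Only the entries with i = j are kept.
  have hTT : ∑ i, T i i k ^ 2 ≤ ∑ i, ∑ j, T i j k ^ 2 :=
    Finset.sum_le_sum fun i _ =>
      Finset.single_le_sum (f := fun j => T i j k ^ 2) (fun j _ => sq_nonneg _) (Finset.mem_univ i)
  have hQ := neg_lorentz_ge hf hκ (h3 k) k
  have hgain := concavity_gain (L := κ k) (y := x k / u) (e := ψ k) (α := α) hf
  have hg : ψ k + α * f / u * (κ k * x k) = ψ k + α * f * κ k * (x k / u) := by ring
  have ht : T k k k = κ k ^ 2 * (x k / u) := by rw [h1]; ring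
  rw [hg, ht] at hQ
  rw [hkk] at h4
  have e1 : κ k / u * (∑ l, ψ l * x l + α * f / u * ∑ l, κ l * x l ^ 2 + 2 * f) =
    κ k / u * (∑ l, ψ l * x l + 2 * f) + α * f / u * (κ k / u * ∑ l, κ l * x l ^ 2) := by ring
  rw [e1] at hsumQ
  -- The y²-coefficients combine as α(α-1) + (2-2α) = (2-α)(1-α).
  have e2 : f * κ k ^ 2 * (2 - α) * (1 + (1 - α) * (x k / u) ^ 2) =
      (2 - α) * κ k ^ 2 * f + α * (α - 1) * f * (κ k * x k / u) ^ 2 +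
        f * κ k ^ 2 * (x k / u) ^ 2 * (2 - 2 * α) := by ring
  have e3 : 2 * α / u * ψ k * (κ k * x k) = 2 * α * ψ k * κ k * (x k / u) := by ring
  rw [e2]
  rw [e3] at h4
  have e4 : α * f / u * (κ k / u * ∑ l, κ l * x l ^ 2 + κ k) =
    α * f / u * (κ k / u * ∑ l, κ l * x l ^ 2) + α * f * κ k / u := by ring
  rw [e4] at h4
  nlinarith only [h4, hsumQ, hTT, hQ, hgain]

theorem le_of_mul_sq_le {L c C : ℝ} (hc : 0 < c) (hC : 0 ≤ C) (h : c * L ^ 2 ≤ C * (1 + L)) :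
    L ≤ 1 + 2 * C / c := by
  by_contra! hlt
  have h0 : 0 ≤ 2 * C / c := by positivity
  have h1 : 1 < L := by linarith
  have h2 : 2 * C < c * L := by
    have : 2 * C / c < L := by linarith
    rwa [div_lt_iff₀ hc, mul_comm L] at this
  nlinarith

theorem curvature_rhs_le {L u f y ψ S Ψ α R : ℝ} (hL : 0 ≤ L) (hu : 0 < u) (hf : 0 < f)
    (huR : 1 / u ≤ R) (hfR : f ≤ R) (hfR' : 1 / f ≤ R) (hy : |y| ≤ R) (hψ : |ψ| ≤ R)
    (hS : S ≤ R) (hΨ : -Ψ ≤ R * (1 + L)) :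
    L / u * (S + 2 * f) - Ψ - 2 * α * ψ * L * y - α * f * L / u + 2 * L * y * ψ +
        2 * f ^ 2 * y ^ 2 * (2 - α) ^ 2 + ψ ^ 2 / f ≤
      (5 * R ^ 2 + R + 3 * |α| * R ^ 2 + 2 * R ^ 4 * (2 - α) ^ 2 + R ^ 3) * (1 + L) := by
  have hR : 0 ≤ R := (abs_nonneg y).trans hy
  have hu' : 0 ≤ 1 / u := by positivity
  have t1 : L / u * (S + 2 * f) ≤ L * (3 * R ^ 2) := by
    calc L / u * (S + 2 * f) = L * (1 / u) * (S + 2 * f) := by ring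
      _ ≤ L * (1 / u) * (3 * R) := by gcongr; linarith
      _ ≤ L * R * (3 * R) := by gcongr
      _ = _ := by ring
  have hψy : |ψ * y| ≤ R ^ 2 := by
    rw [abs_mul, sq]; gcongr
  have t2 : -(2 * α * ψ * L * y) ≤ 2 * |α| * R ^ 2 * L := by
    calc -(2 * α * ψ * L * y) ≤ |2 * α * ψ * L * y| := neg_le_abs _
      _ = 2 * |α| * |ψ * y| * L := by
        rw [show 2 * α * ψ * L * y = 2 * α * (ψ * y) * L by ring, abs_mul, abs_mul, abs_mul,
          abs_of_nonneg hL, abs_two]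
      _ ≤ _ := by gcongr
  have t3 : -(α * f * L / u) ≤ |α| * R ^ 2 * L := by
    calc -(α * f * L / u) ≤ |α * f * L / u| := neg_le_abs _
      _ = |α| * f * L * (1 / u) := by
        rw [abs_div, abs_mul, abs_mul, abs_of_nonneg hL, abs_of_pos hf, abs_of_pos hu]; ring
      _ ≤ |α| * R * L * R := by gcongr
      _ = _ := by ring
  have t4 : 2 * L * y * ψ ≤ 2 * R ^ 2 * L := by
    calc 2 * L * y * ψ = 2 * (ψ * y) * L := by ring
      _ ≤ _ := by gcongr; exact (le_abs_self _).trans hψy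
  have hy2 : y ^ 2 ≤ R ^ 2 := sq_le_sq.2 (by rwa [abs_of_nonneg hR])
  have hψ2 : ψ ^ 2 ≤ R ^ 2 := sq_le_sq.2 (by rwa [abs_of_nonneg hR])
  have t5 : 2 * f ^ 2 * y ^ 2 * (2 - α) ^ 2 ≤ 2 * R ^ 4 * (2 - α) ^ 2 := by
    calc 2 * f ^ 2 * y ^ 2 * (2 - α) ^ 2 ≤ 2 * R ^ 2 * R ^ 2 * (2 - α) ^ 2 := by gcongr
      _ = _ := by ring
  have t6 : ψ ^ 2 / f ≤ R ^ 3 := by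
    calc ψ ^ 2 / f = ψ ^ 2 * (1 / f) := by ring
      _ ≤ R ^ 2 * R := by gcongr
      _ = _ := by ring
  have p1 : 0 ≤ 2 * R ^ 4 * (2 - α) ^ 2 * L := by positivity
  have p2 : 0 ≤ R ^ 3 * L := by positivity
  have p3 : 0 ≤ 3 * |α| * R ^ 2 := by positivity
  have p4 : 0 ≤ R ^ 2 := by positivity
  nlinarith only [t1, t2, t3, t4, t5, t6, p1, p2, p3, p4, hΨ]

end

/-! ### Jets along the frame lines at the maximum point -/

section

variable {n : ℕ} {ρ φ : E n → ℝ} {X₀ : E n}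

theorem hasTwoDeriv_metric {q : Fin n → ℝ → ℝ} {p τ : Fin n → ℝ} {c : ℝ} {l : Fin n}
    (hp : ∀ i, p i = if i = l then c else 0) (hq : ∀ i, HasTwoDeriv (q i) 0 (p i) (τ i)) :
    HasTwoDeriv (fun t => 1 + ∑ i, q i t ^ 2) 1 0 (2 * c ^ 2) := by
  convert (HasTwoDeriv.const 1).add (HasTwoDeriv.sum Finset.univ fun i _ => (hq i).sq) using 1
  · simp
  · simp
  · simp [hp, ite_pow]

theorem hasTwoDeriv_graphSupport {q : Fin n → ℝ → ℝ} {w : ℝ → ℝ} {p τ x : Fin n → ℝ} {c u : ℝ}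
    {l : Fin n} (hp : ∀ i, p i = if i = l then c else 0)
    (hq : ∀ i, HasTwoDeriv (q i) 0 (p i) (τ i)) (hw : HasTwoDeriv w 0 0 c) :
    HasTwoDeriv (fun t => u + ∑ i, (x i + t * if i = l then 1 else 0) * q i t - w t) u (c * x l)
      (∑ i, τ i * x i + c) := by
  have h := (((HasTwoDeriv.const u).add (HasTwoDeriv.sum Finset.univ fun i _ =>
    ((HasTwoDeriv.const (x i)).add (HasTwoDeriv.id.mul
      (HasTwoDeriv.const (if i = l then 1 else 0)))).mul (hq i))).sub hw)
  convert h using 1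
  · simp
  · simp [hp, mul_comm]
  · simp [hp, Finset.sum_add_distrib, mul_comm]
    ring

/-- At the base point the gradient is zero and the Hessian diagonal, and along e_l only the l-th
gradient component has nonzero velocity. Hence the metric corrections contribute only powers of κ_l
and the two symmetric functions. -/
theorem hasTwoDeriv_hessianSigma {W : Fin n → Fin n → ℝ → ℝ} {q : Fin n → ℝ → ℝ}
    {κ p τ : Fin n → ℝ} {T R : Fin n → Fin n → ℝ} {l : Fin n}
    (hp : ∀ i, p i = if i = l then κ l else 0) (hq : ∀ i, HasTwoDeriv (q i) 0 (p i) (τ i))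
    (hW : ∀ i j, HasTwoDeriv (W i j) (if i = j then κ i else 0) (T i j) (R i j)) :
    HasTwoDeriv (fun t => hessianSigma (fun i j => W i j t) (fun i => q i t))
      ((∑ i, κ i) ^ 2 - ∑ i, κ i ^ 2) (2 * ∑ i, ((∑ j, κ j) - κ i) * T i i)
      (2 * (∑ i, ((∑ j, κ j) - κ i) * R i i + (∑ i, T i i) ^ 2 - ∑ i, ∑ j, T i j ^ 2 +
        2 * κ l ^ 2 * (((∑ i, κ i) ^ 2 - ∑ i, κ i ^ 2) / 2 - κ l * ((∑ j, κ j) - κ l)))) := by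
  have hD := hasTwoDeriv_metric hp hq
  have htr : HasTwoDeriv (fun t => ∑ i, W i i t) (∑ i, κ i) (∑ i, T i i) (∑ i, R i i) := by
    simpa using HasTwoDeriv.sum Finset.univ fun i _ => hW i i
  have hsq : HasTwoDeriv (fun t => ∑ i, ∑ j, W i j t ^ 2) (∑ i, κ i ^ 2) (2 * ∑ i, κ i * T i i)
      (2 * ∑ i, κ i * R i i + 2 * ∑ i, ∑ j, T i j ^ 2) := by
    convert HasTwoDeriv.sum Finset.univ fun i _ => HasTwoDeriv.sum Finset.univ fun j _ =>
      (hW i j).sq using 1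
    · simp [ite_pow]
    · simp [Finset.mul_sum, mul_assoc]
    · simp [Finset.mul_sum, mul_assoc, Finset.sum_add_distrib]
  have hWqq : HasTwoDeriv (fun t => ∑ i, ∑ j, W i j t * (q i t * q j t)) 0 0 (2 * κ l ^ 3) := by
    convert HasTwoDeriv.sum Finset.univ fun i _ => HasTwoDeriv.sum Finset.univ fun j _ =>
      (hW i j).mul ((hq i).mul (hq j)) using 1
    · simp
    · simp
    · simp [hp]
      ring
  have hWq : HasTwoDeriv (fun t => ∑ i, (∑ j, W i j t * q j t) ^ 2) 0 0 (2 * κ l ^ 4) := by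
    convert HasTwoDeriv.sum Finset.univ fun i _ => (HasTwoDeriv.sum Finset.univ fun j _ =>
      (hW i j).mul (hq j)).sq using 1
    · simp
    · simp
    · simp [hp, ite_pow, mul_pow]
      ring
  have h := ((hD.mul (htr.sq.sub hsq)).sub ((htr.mul hWqq).const_mul 2)).add (hWq.const_mul 2)
  convert h using 1
  · rfl
  · ring
  · simp only [sub_mul, Finset.sum_sub_distrib, ← Finset.mul_sum]
    ring
  · simp only [sub_mul, Finset.sum_sub_distrib, ← Finset.mul_sum]
    ring

theorem hasTwoDeriv_comp {V : Type*} [NormedAddCommGroup V] [NormedSpace ℝ V] {φ : V → ℝ}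
    (hφ : ContDiff ℝ 2 φ) {γ γ' : ℝ → V} {a : V} (h : ∀ᶠ t in 𝓝 0, HasDerivAt γ (γ' t) t)
    (hvel : HasDerivAt γ' a 0) :
    HasTwoDeriv (fun t => φ (γ t)) (φ (γ 0)) (fderiv ℝ φ (γ 0) (γ' 0))
      (fderiv ℝ (fderiv ℝ φ) (γ 0) (γ' 0) (γ' 0) + fderiv ℝ φ (γ 0) a) := by
  have hd : Differentiable ℝ φ := hφ.differentiable (by norm_num)
  have hd2 : Differentiable ℝ (fderiv ℝ φ) :=
    (hφ.fderiv_right (m := 1) (by norm_num)).differentiable (by norm_num)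
  refine ⟨rfl, fun t => fderiv ℝ φ (γ t) (γ' t), ?_, rfl, ?_⟩
  · filter_upwards [h] with t ht using (hd (γ t)).hasFDerivAt.comp_hasDerivAt t ht
  · exact ((hd2 (γ 0)).hasFDerivAt.comp_hasDerivAt 0 h.self_of_nhds).clm_apply hvel

/-- At a maximum point of the quotient of the largest principal curvature by the support function,
with principal directions `e` and principal curvatures `κ`. -/
theorem curvature_inequality_at_max (hρ : IsRadialFunction 4 ρ) (hX₀ : X₀ ∈ hypersurface ρ)
    (hφ : ContDiff ℝ 2 φ) {α : ℝ}
    (heq : ∀ X ∈ hypersurface ρ, sigma 2 ρ X = φ X * support ρ X ^ α)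
    {e : Fin n → E n} (hF : IsFrame (normal ρ X₀) e) {κ : Fin n → ℝ}
    (hdiag : ∀ i j, ⟪fderiv ℝ (normal ρ) X₀ (e i), e j⟫ = if i = j then κ i else 0)
    (hκ : 0 < ∑ i, κ i) (hφ₀ : 0 < φ X₀) (k : Fin n)
    (hmax : ∀ Y ∈ hypersurface ρ, ∀ v ∈ tangent ρ Y,
      ⟪fderiv ℝ (normal ρ) Y v, v⟫ ≤ κ k / support ρ X₀ * support ρ Y * ‖v‖ ^ 2)
    {u f : ℝ} (hu : u = support ρ X₀) (hf : f = φ X₀ * u ^ α)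
    {ψ : E n → ℝ} (hψ : ∀ v, ψ v = u ^ α * fderiv ℝ φ X₀ v) {x : Fin n → ℝ}
    (hx : ∀ i, x i = ⟪X₀, e i⟫) {Ψ : ℝ} (hΨ : Ψ = u ^ α *
      (fderiv ℝ (fderiv ℝ φ) X₀ (e k) (e k) - κ k * fderiv ℝ φ X₀ (normal ρ X₀))) :
    f * κ k ^ 2 * (2 - α) * (1 + (1 - α) * (x k / u) ^ 2) ≤
      κ k / u * (∑ l, ψ (e l) * x l + 2 * f) - Ψ - 2 * α * ψ (e k) * κ k * (x k / u) -
        α * f * κ k / u + 2 * κ k * (x k / u) * ψ (e k) + 2 * f ^ 2 * (x k / u) ^ 2 * (2 - α) ^ 2 +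
        ψ (e k) ^ 2 / f := by
  obtain ⟨w, hw, hw0, hq0, hgr⟩ := hρ.exists_graph hX₀ hF
  set ν := normal ρ X₀ with hν
  have hu0 : 0 < u := hu ▸ hρ.support_pos hX₀
  have hf0 : 0 < f := hf ▸ mul_pos hφ₀ (Real.rpow_pos_of_pos hu0 α)
  have hw2 : ContDiffAt ℝ 2 w 0 := hw.of_le (by norm_num)
  have hw3 : ∀ i, ContDiffAt ℝ 3 (dirDeriv (e i) w) 0 := fun i =>
    contDiffAt_dirDeriv hw (by norm_num) _
  have hw32 : ∀ i, ContDiffAt ℝ 2 (dirDeriv (e i) w) 0 := fun i => (hw3 i).of_le (by norm_num)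
  have hW2 : ∀ i j, ContDiffAt ℝ 2 (dirDeriv (e i) (dirDeriv (e j) w)) 0 := fun i j =>
    contDiffAt_dirDeriv (hw3 j) (by norm_num) _
  have hW0 : ∀ i j, dirDeriv (e i) (dirDeriv (e j) w) 0 = if i = j then κ i else 0 := by
    intro i j
    have h := (hgr.self_of_nhds (by simp)).inner_fderiv_normal i j
    simp only [hw0, hq0, zero_smul, add_zero, sub_zero, hdiag] at h
    simpa using h.symm
  set T : Fin n → Fin n → Fin n → ℝ := fun i j l =>
    dirDeriv (e l) (dirDeriv (e i) (dirDeriv (e j) w)) 0 with hT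
  have hTsym : ∀ i j l, T i j l = T j i l := fun i j l =>
    (dirDeriv_congr (dirDeriv_comm_eventually hw2 (e i) (e j)) (e l)).self_of_nhds
  have hTsym' : ∀ i j l, T i j l = T l j i := fun i j l => dirDeriv_comm (hw32 j) (e l) (e i)
  have hqjet : ∀ l i, HasTwoDeriv (fun t : ℝ => dirDeriv (e i) w (t • e l)) 0
      (if i = l then κ l else 0) (T l i l) := by
    intro l i
    have h := hasTwoDeriv_line (hw32 i) (e l)
    rw [hq0, hW0] at h
    simpa [eq_comm] using h
  have hWjet : ∀ l i j, HasTwoDeriv (fun t : ℝ => dirDeriv (e i) (dirDeriv (e j) w) (t • e l))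
      (if i = j then κ i else 0) (T i j l)
      (dirDeriv (e l) (dirDeriv (e l) (dirDeriv (e i) (dirDeriv (e j) w))) 0) := by
    intro l i j
    have h := hasTwoDeriv_line (hW2 i j) (e l)
    rwa [hW0] at h
  have hwjet : ∀ l, HasTwoDeriv (fun t : ℝ => w (t • e l)) 0 0 (κ l) := by
    intro l
    have h := hasTwoDeriv_line hw2 (e l)
    rw [hw0, hq0, hW0] at h
    simpa using h
  let U : Fin n → ℝ → ℝ := fun l t =>
    u + ∑ i, (x i + t * if i = l then 1 else 0) * dirDeriv (e i) w (t • e l) - w (t • e l)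
  have hUjet : ∀ l, HasTwoDeriv (U l) u (κ l * x l) (∑ i, T l i l * x i + κ l) := fun l =>
    hasTwoDeriv_graphSupport (fun _ => rfl) (hqjet l) (hwjet l)
  let D : Fin n → ℝ → ℝ := fun l t => 1 + ∑ i, dirDeriv (e i) w (t • e l) ^ 2
  have hDjet : ∀ l, HasTwoDeriv (D l) 1 0 (2 * κ l ^ 2) := fun l =>
    hasTwoDeriv_metric (fun _ => rfl) (hqjet l)
  have hDpos : ∀ l t, 0 < D l t := fun l t => by positivity
  have hline : ∀ l, Tendsto (fun t : ℝ => t • e l) (𝓝 0) (𝓝 0) := fun l => by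
    have : ContinuousAt (fun t : ℝ => t • e l) 0 := by fun_prop
    simpa [ContinuousAt] using this
  have hνl : ∀ l (t : ℝ), ⟪ν, t • e l⟫ = 0 := fun l t => by
    rw [inner_smul_right, hF.inner_normal, mul_zero]
  have hgraph : ∀ l, ∀ᶠ t : ℝ in 𝓝 0, IsGraphAt ρ X₀ ν e w (t • e l) := fun l => by
    filter_upwards [(hline l).eventually hgr] with t ht using ht (hνl l t)
  have hwl : ∀ l, ∀ᶠ t : ℝ in 𝓝 0, ContDiffAt ℝ 4 w (t • e l) := fun l =>
    (hline l).eventually (hw.eventually (by norm_num))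
  have hsupp : ∀ l, ∀ᶠ t : ℝ in 𝓝 0,
      support ρ (X₀ + t • e l - w (t • e l) • ν) = (√(D l t))⁻¹ * U l t := by
    intro l
    filter_upwards [hgraph l] with t ht
    rw [ht.support_eq hF (hνl l t)]
    have hu' : ⟪X₀, ν⟫ = u := hu.symm
    simp only [hu', ← hx, inner_smul_left, hF.inner_frame, conj_trivial, D, U,
      eq_comm (a := l)]
  have htest : ∀ i, T k k i - κ k / u * (κ i * x i) = 0 ∧
      dirDeriv (e i) (dirDeriv (e i) (dirDeriv (e k) (dirDeriv (e k) w))) 0 -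
        κ k / u * (2 * (if k = i then κ i else 0) ^ 2 * u + (∑ j, T i j i * x j + κ i)) ≤ 0 := by
    intro i
    have hjet := (hWjet i k k).sub
      ((((HasTwoDeriv.const 1).add (hqjet i k).sq).mul (hUjet i)).const_mul (κ k / u))
    -- The maximality inequality is tested at nearby points on the tangent vector e_k - w_k ν, of
    -- squared length 1 + w_k². Both sides carry the factor D^(-1/2), which cancels.
    have hloc : IsLocalMax (fun t => dirDeriv (e k) (dirDeriv (e k) w) (t • e i) -
        κ k / u * ((1 + dirDeriv (e k) w (t • e i) ^ 2) * U i t)) 0 := by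
      filter_upwards [hgraph i, hsupp i] with t ht hs
      have h0 : dirDeriv (e k) (dirDeriv (e k) w) ((0 : ℝ) • e i) -
          κ k / u * ((1 + dirDeriv (e k) w ((0 : ℝ) • e i) ^ 2) * U i 0) = 0 := by
        have : U i 0 = u := by simp [U, hw0, hq0]
        simp only [this, zero_smul, hW0, hq0, if_true]
        field_simp
        ring
      rw [h0, sub_nonpos]
      set v := e k - dirDeriv (e k) w (t • e i) • ν with hv
      have hvn : ‖v‖ ^ 2 = 1 + dirDeriv (e k) w (t • e i) ^ 2 := by
        rw [← real_inner_self_eq_norm_sq, hv]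
        simp only [inner_sub_left, inner_sub_right, inner_smul_left, inner_smul_right,
          hF.inner_self, hF.inner_normal, hF.inner_normal', hF.inner_frame, if_true, conj_trivial]
        ring
      have hvt : v ∈ tangent ρ (X₀ + t • e i - w (t • e i) • ν) := by
        rw [mem_tangent_iff, ht.normal_eq, inner_smul_left, inner_add_left, hv, inner_sub_right,
          inner_sub_right, inner_smul_right, inner_smul_right, hF.inner_combination,
          hF.inner_normal, hF.inner_self, real_inner_comm, hF.inner_normal_combination]
        ring
      have h1 := hmax _ ht.mem v hvt
      rw [ht.inner_fderiv_normal, hs, hvn, ← hu] at h1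
      have hsq : 0 < (√(D i t))⁻¹ := inv_pos.2 (Real.sqrt_pos.2 (hDpos i t))
      refine le_of_mul_le_mul_left (h1.trans_eq ?_) hsq
      ring
    have h := hjet.of_isLocalMax hloc
    constructor
    · have h1 := h.1
      simp at h1
      linarith
    · have h2 := h.2
      simp at h2
      split_ifs at h2 ⊢
      · linarith
      · linarith
  have hpde : ∀ l, HasTwoDeriv (fun t : ℝ => hessianSigma
      (fun i j => dirDeriv (e i) (dirDeriv (e j) w) (t • e l))
      (fun i => dirDeriv (e i) w (t • e l))) (2 * f)
      (2 * (ψ (e l) + α * f / u * (κ l * x l)))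
      (2 * ((4 - α) * κ l ^ 2 * f + u ^ α * (fderiv ℝ (fderiv ℝ φ) X₀ (e l) (e l) -
        κ l * fderiv ℝ φ X₀ ν) + 2 * α / u * ψ (e l) * (κ l * x l) +
        α * f / u * (∑ i, T l i l * x i + κ l) + α * (α - 1) * f * (κ l * x l / u) ^ 2)) := by
    intro l
    have hγ : ∀ᶠ t : ℝ in 𝓝 0, HasDerivAt (fun t : ℝ => X₀ + t • e l - w (t • e l) • ν)
        (e l - dirDeriv (e l) w (t • e l) • ν) t := by
      filter_upwards [hwl l] with t ht
      have h1 : HasDerivAt (fun t : ℝ => t • e l) (e l) t := by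
        simpa using (hasDerivAt_id t).smul_const (e l)
      have h2 : HasDerivAt (fun t : ℝ => w (t • e l)) (dirDeriv (e l) w (t • e l)) t :=
        (ht.differentiableAt (by norm_num)).hasFDerivAt.comp_hasDerivAt t h1
      exact (h1.const_add X₀).sub (h2.smul_const ν)
    have hγ' : HasDerivAt (fun t : ℝ => e l - dirDeriv (e l) w (t • e l) • ν) (-(κ l • ν)) 0 := by
      have h1 := (hqjet l l).hasDerivAt
      rw [if_pos rfl] at h1
      exact (h1.smul_const ν).const_sub (e l)
    have hφjet := hasTwoDeriv_comp hφ hγ hγ'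
    simp only [zero_smul, hw0, hq0, add_zero, sub_zero, map_neg, map_smul, smul_eq_mul] at hφjet
    -- In the exponent, 2 comes from clearing the denominator of σ₂ and -α/2 from the factor
    -- D^(-1/2) in the support function. With D'' = 2κ_l² this produces (4-α)κ_l² f.
    have hprod := ((((hDjet l).rpow one_pos (2 - α / 2)).mul hφjet).mul
      ((hUjet l).rpow hu0 α)).const_mul 2
    have hEq : (fun t => 2 * (D l t ^ (2 - α / 2) * φ (X₀ + t • e l - w (t • e l) • ν) *
        U l t ^ α)) =ᶠ[𝓝 0] fun t : ℝ => hessianSigma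
          (fun i j => dirDeriv (e i) (dirDeriv (e j) w) (t • e l))
          (fun i => dirDeriv (e i) w (t • e l)) := by
      filter_upwards [hgraph l, hsupp l, hwl l] with t ht hs hwt
      rw [← ht.sigma_two_eq hρ hF (hwt.of_le (by norm_num)), heq _ ht.mem, hs]
      have hD := hDpos l t
      have hUt : 0 < U l t := by
        have := hρ.support_pos ht.mem
        rw [hs] at this
        exact (mul_pos_iff_of_pos_left (inv_pos.2 (Real.sqrt_pos.2 hD))).1 this
      rw [Real.mul_rpow (inv_nonneg.2 (Real.sqrt_nonneg _)) hUt.le, Real.inv_rpow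
        (Real.sqrt_nonneg _), Real.sqrt_eq_rpow, ← Real.rpow_mul hD.le, Real.rpow_sub hD,
        Real.rpow_two, one_div, inv_mul_eq_div]
      change _ = D l t ^ 2 * _
      ring_nf
    have h := hprod.congr hEq
    have e1 : u ^ (α - 1) = u ^ α / u := by rw [Real.rpow_sub hu0, Real.rpow_one]
    have e2 : u ^ (α - 2) = u ^ α / u ^ 2 := by rw [Real.rpow_sub hu0, Real.rpow_two]
    convert h using 1
    · rw [hf, Real.one_rpow]; ring
    · rw [hf, hψ, e1]; simp only [Real.one_rpow]; ring
    · rw [hf, hψ, e1, e2]; simp only [Real.one_rpow]; ring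
  have hboth : ∀ l, _ := fun l => (hasTwoDeriv_hessianSigma (fun _ => rfl) (hqjet l)
    (hWjet l)).unique (hpde l)
  have hκf : (∑ i, κ i) ^ 2 - ∑ i, κ i ^ 2 = 2 * f := (hboth k).1
  refine curvature_inequality (T := T) (ψ := fun l => ψ (e l)) (Ψ := Ψ)
    (Q := fun i => dirDeriv (e k) (dirDeriv (e k) (dirDeriv (e i) (dirDeriv (e i) w))) 0)
    k hf0 hκf hκ ?_ ?_ ?_ ?_
  · intro i
    linarith [(htest i).1]
  · intro i
    have h := (htest i).2
    have hs : ∀ j, T i j i = T i i j := fun j => by rw [hTsym i j i, hTsym' j i i]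
    simp only [hs] at h
    -- Maximality differentiates w_kk twice along e_i, the equation differentiates w_ii twice along
    -- e_k; commuting them allows the fourth-order terms to be eliminated.
    rw [dirDeriv_fourth_comm hw]
    refine (sub_nonpos.1 h).trans_eq ?_
    by_cases hik : i = k
    · subst hik; simp; field_simp
    · simp [hik, Ne.symm hik]
  · intro l
    linarith [(hboth l).2.1]
  · have h := (hboth k).2.2
    rw [hκf] at h
    have hs : ∀ j, T k j k = T k k j := fun j => by rw [hTsym k j k, hTsym' j k k]
    simp only [hs] at h
    rw [hΨ]
    linarith

end

/-! ### Constants and the curvature bound at the maximum point -/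

section

variable {n : ℕ} {ρ φ : E n → ℝ} {X₀ : E n}

/-- The power is monotone with direction depending on the sign of the exponent; adding both endpoint
values covers either sign. -/
theorem rpow_le_add_rpow {c u K : ℝ} (hc : 0 < c) (hcu : c ≤ u) (huK : u ≤ K) (a : ℝ) :
    u ^ a ≤ c ^ a + K ^ a := by
  have hu : 0 < u := hc.trans_le hcu
  rcases le_total 0 a with ha | ha
  · exact (Real.rpow_le_rpow hu.le huK ha).trans
      (le_add_of_nonneg_left (Real.rpow_nonneg hc.le a))
  · exact (Real.rpow_le_rpow_of_nonpos hc hcu ha).trans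
      (le_add_of_nonneg_right (Real.rpow_nonneg (hu.le.trans huK) a))

/-- A common bound for the zeroth order quantities in the curvature estimate. -/
def dataBound (α A B K : ℝ) : ℝ :=
  (K + K ^ 3) + K * (K + K ^ 3) + B * ((K + K ^ 3)⁻¹ ^ (-α) + K ^ (-α)) +
    ((K + K ^ 3)⁻¹ ^ α + K ^ α) * A * (1 + 2 * K)

/-- A bound for the largest principal curvature at a maximum point of its quotient by the support
function. -/
def curvatureBound (α A B K : ℝ) : ℝ :=
  1 + 2 * (5 * dataBound α A B K ^ 2 + dataBound α A B K + 3 * |α| * dataBound α A B K ^ 2 +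
    2 * dataBound α A B K ^ 4 * (2 - α) ^ 2 + dataBound α A B K ^ 3) /
      ((dataBound α A B K)⁻¹ * (2 - α) * ((K + K ^ 3)⁻¹ / K) ^ 2)

/-- Only α > 1 needs care: then (α-1)y² is at most (u²/N²)(N²/u² - 1) = 1 - u²/N². -/
theorem one_add_mul_sq_ge {α u N y : ℝ} (hu : 0 < u) (huN : u ≤ N)
    (hα : α < 1 + u ^ 2 / N ^ 2) (hy : u ^ 2 * y ^ 2 ≤ N ^ 2 - u ^ 2) :
    u ^ 2 / N ^ 2 ≤ 1 + (1 - α) * y ^ 2 := by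
  have hN : 0 < N := hu.trans_le huN
  have h1 : u ^ 2 / N ^ 2 ≤ 1 := by
    rw [div_le_one (by positivity)]
    gcongr
  rcases le_total α 1 with h | h
  · nlinarith [sq_nonneg y]
  · have h2 : (α - 1) * y ^ 2 ≤ u ^ 2 / N ^ 2 * y ^ 2 := by
      gcongr
      linarith
    have h3 : u ^ 2 / N ^ 2 * y ^ 2 ≤ 1 - u ^ 2 / N ^ 2 := by
      calc u ^ 2 / N ^ 2 * y ^ 2 = u ^ 2 * y ^ 2 / N ^ 2 := by ring
        _ ≤ (N ^ 2 - u ^ 2) / N ^ 2 := by gcongr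
        _ = _ := by field_simp
    linarith

theorem abs_fderiv_le {A : ℝ} (h : ∀ j ≤ 2, ‖iteratedFDeriv ℝ j φ X₀‖ ≤ A) (v : E n) :
    |fderiv ℝ φ X₀ v| ≤ A * ‖v‖ := by
  have h1 := h 1 (by norm_num)
  rw [norm_iteratedFDeriv_one] at h1
  exact (fderiv ℝ φ X₀).le_of_opNorm_le h1 v

theorem abs_fderiv_fderiv_le {A : ℝ} (h : ∀ j ≤ 2, ‖iteratedFDeriv ℝ j φ X₀‖ ≤ A) (v : E n) :
    |fderiv ℝ (fderiv ℝ φ) X₀ v v| ≤ A * ‖v‖ ^ 2 := by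
  have h1 := (iteratedFDeriv ℝ 2 φ X₀).le_of_opNorm_le (h 2 le_rfl) ![v, v]
  rw [iteratedFDeriv_two_apply] at h1
  simpa [Fin.prod_univ_two, sq] using h1

/-- Quadratic homogeneity, so that test vectors at the maximum point need not be normalised. -/
theorem inner_fderiv_normal_le {Y : E n} {m : ℝ}
    (h : ∀ η : tangent ρ Y, ‖η‖ = 1 → secondFF ρ Y η η ≤ m) {v : E n} (hv : v ∈ tangent ρ Y) :
    ⟪fderiv ℝ (normal ρ) Y v, v⟫ ≤ m * ‖v‖ ^ 2 := by
  rcases eq_or_ne v 0 with rfl | hv0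
  · simp
  · have hvn : ‖v‖ ≠ 0 := norm_ne_zero_iff.2 hv0
    let η : tangent ρ Y := ⟨‖v‖⁻¹ • v, Submodule.smul_mem _ _ hv⟩
    have hη : ‖η‖ = 1 := by
      rw [Submodule.coe_norm]
      exact norm_smul_inv_norm hv0
    have h1 := h η hη
    have h2 : secondFF ρ Y η η = ⟪fderiv ℝ (normal ρ) Y v, v⟫ / ‖v‖ ^ 2 := by
      change ⟪fderiv ℝ (normal ρ) Y (‖v‖⁻¹ • v), ‖v‖⁻¹ • v⟫ = _
      rw [map_smul, inner_smul_left, inner_smul_right, conj_trivial]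
      field_simp
    rwa [h2, div_le_iff₀ (by positivity)] at h1

theorem curvature_le_at_max (hρ : IsRadialFunction 4 ρ) (hX₀ : X₀ ∈ hypersurface ρ)
    (hφ : ContDiff ℝ 2 φ) {α A B K : ℝ} (hK : C1Bound ρ K)
    (hA : ∀ j ≤ 2, ‖iteratedFDeriv ℝ j φ X₀‖ ≤ A) (hB : 1 / φ X₀ ≤ B) (hφ₀ : 0 < φ X₀)
    (hα : α < 1 + delta ρ)
    (heq : ∀ X ∈ hypersurface ρ, sigma 2 ρ X = φ X * support ρ X ^ α)
    {e : Fin n → E n} (hF : IsFrame (normal ρ X₀) e) {κ : Fin n → ℝ}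
    (hdiag : ∀ i j, ⟪fderiv ℝ (normal ρ) X₀ (e i), e j⟫ = if i = j then κ i else 0)
    (hκ : 0 < ∑ i, κ i) (k : Fin n) (hk : 0 ≤ κ k)
    (hmax : ∀ Y ∈ hypersurface ρ, ∀ v ∈ tangent ρ Y,
      ⟪fderiv ℝ (normal ρ) Y v, v⟫ ≤ κ k / support ρ X₀ * support ρ Y * ‖v‖ ^ 2) :
    κ k ≤ curvatureBound α A B K := by
  set u := support ρ X₀ with hu
  set N := ‖X₀‖ with hN
  set c := (K + K ^ 3)⁻¹ with hc
  set R := dataBound α A B K with hR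
  have hK0 : 0 < K := hρ.bound_pos hK hX₀
  have hKK : 0 < K + K ^ 3 := by positivity
  have hc0 : 0 < c := inv_pos.2 hKK
  have hu0 : 0 < u := hρ.support_pos hX₀
  have hcu : c ≤ u := hρ.support_ge hK hX₀
  have huN : u ≤ N := hρ.support_le_norm hX₀
  have hNK : N ≤ K := hρ.norm_le hK hX₀
  have hN0 : 0 < N := hu0.trans_le huN
  have hα' : α < 1 + u ^ 2 / N ^ 2 := hα.trans_le (by linarith [delta_le hX₀])
  have hα2 : α < 2 := by
    have : u ^ 2 / N ^ 2 ≤ 1 := by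
      rw [div_le_one (by positivity)]
      gcongr
    linarith
  have hA0 : 0 ≤ A := (norm_nonneg _).trans (hA 0 (by norm_num))
  have hB0 : 0 ≤ B := le_trans (by positivity) hB
  have hφA : φ X₀ ≤ A := by
    have := hA 0 (by norm_num)
    rw [norm_iteratedFDeriv_zero] at this
    exact (le_abs_self _).trans this
  set P := c ^ α + K ^ α with hP
  have hP0 : 0 ≤ P := by positivity
  have huP : u ^ α ≤ P := rpow_le_add_rpow hc0 hcu (huN.trans hNK) α
  have huP0 : 0 < u ^ α := Real.rpow_pos_of_pos hu0 α
  set P' := c ^ (-α) + K ^ (-α) with hP'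
  have hP'0 : 0 ≤ P' := by positivity
  have huP' : u ^ (-α) ≤ P' := rpow_le_add_rpow hc0 hcu (huN.trans hNK) (-α)
  have hRdef : R = (K + K ^ 3) + K * (K + K ^ 3) + B * P' + P * A * (1 + 2 * K) := rfl
  have p1 : 0 ≤ K * (K + K ^ 3) := by positivity
  have p2 : 0 ≤ B * P' := by positivity
  have p3 : 0 ≤ P * A := by positivity
  have p4 : 0 ≤ P * A * (2 * K) := by positivity
  have hR0 : 0 < R := by rw [hRdef]; linarith
  set f := φ X₀ * u ^ α with hf
  have hf0 : 0 < f := mul_pos hφ₀ huP0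
  have hfR : f ≤ R := by
    have : f ≤ A * P := by rw [hf]; gcongr
    rw [hRdef]; linarith
  have hfR' : 1 / f ≤ R := by
    have : 1 / f ≤ B * P' := by
      calc 1 / f = 1 / φ X₀ * u ^ (-α) := by rw [hf, Real.rpow_neg hu0.le]; field_simp
        _ ≤ B * P' := by gcongr
    rw [hRdef]; linarith
  have huR : 1 / u ≤ R := by
    have : 1 / u ≤ K + K ^ 3 := by
      rw [one_div, ← inv_inv (K + K ^ 3)]
      exact inv_anti₀ hc0 hcu
    rw [hRdef]; linarith
  -- X₀ is split into its normal component u and its tangential components, which bounds y² by N²/u²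
  -- - 1.
  have hpyth : u ^ 2 + ∑ i, ⟪X₀, e i⟫ ^ 2 = N ^ 2 := by
    rw [hN, ← real_inner_self_eq_norm_sq]
    nth_rewrite 3 [hF.expand X₀]
    rw [inner_add_right, inner_sum, inner_smul_right, real_inner_comm X₀]
    simp only [inner_smul_right, real_inner_comm X₀, hu, support]
    simp [sq]
  have hxk : ⟪X₀, e k⟫ ^ 2 ≤ N ^ 2 - u ^ 2 := by
    have : ⟪X₀, e k⟫ ^ 2 ≤ ∑ i, ⟪X₀, e i⟫ ^ 2 :=
      Finset.single_le_sum (f := fun i => (⟪X₀, e i⟫ : ℝ) ^ 2) (fun i _ => sq_nonneg _)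
        (Finset.mem_univ k)
    linarith
  have hen : ∀ i, ‖e i‖ = 1 := hF.orthonormal.1
  have hy : |⟪X₀, e k⟫ / u| ≤ R := by
    have h1 : |⟪X₀, e k⟫| ≤ K := by
      have := abs_real_inner_le_norm X₀ (e k)
      rw [hen, mul_one] at this
      exact this.trans hNK
    have h2 : |⟪X₀, e k⟫ / u| ≤ K * (K + K ^ 3) := by
      rw [abs_div, abs_of_pos hu0, div_eq_mul_inv]
      have : u⁻¹ ≤ K + K ^ 3 := by
        rw [← inv_inv (K + K ^ 3)]
        exact inv_anti₀ hc0 hcu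
      gcongr
    rw [hRdef]; linarith
  have hψ : |u ^ α * fderiv ℝ φ X₀ (e k)| ≤ R := by
    have h1 := abs_fderiv_le hA (e k)
    rw [hen, mul_one] at h1
    have : |u ^ α * fderiv ℝ φ X₀ (e k)| ≤ P * A := by
      rw [abs_mul, abs_of_pos huP0]
      gcongr
    rw [hRdef]; linarith
  have hS : ∑ l, u ^ α * fderiv ℝ φ X₀ (e l) * ⟪X₀, e l⟫ ≤ R := by
    have h1 : ∑ l, u ^ α * fderiv ℝ φ X₀ (e l) * ⟪X₀, e l⟫ =
        u ^ α * fderiv ℝ φ X₀ (X₀ - u • normal ρ X₀) := by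
      have h2 : X₀ - u • normal ρ X₀ = ∑ l, ⟪X₀, e l⟫ • e l := by
        have := hF.expand X₀
        rw [real_inner_comm X₀] at this
        simp only [real_inner_comm X₀] at this
        rw [sub_eq_iff_eq_add']
        exact this
      rw [h2, map_sum, Finset.mul_sum]
      exact Finset.sum_congr rfl fun l _ => by rw [map_smul, smul_eq_mul]; ring
    have h3 : ‖X₀ - u • normal ρ X₀‖ ≤ 2 * K := by
      refine (norm_sub_le _ _).trans ?_
      rw [norm_smul, hF.norm_normal, mul_one, Real.norm_of_nonneg hu0.le]
      linarith
    have h4 : u ^ α * fderiv ℝ φ X₀ (X₀ - u • normal ρ X₀) ≤ P * (A * (2 * K)) := by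
      calc _ ≤ u ^ α * (A * ‖X₀ - u • normal ρ X₀‖) := by
            gcongr
            exact (le_abs_self _).trans (abs_fderiv_le hA _)
        _ ≤ _ := by gcongr
    rw [h1, hRdef]
    linarith
  have hΨ : -(u ^ α * (fderiv ℝ (fderiv ℝ φ) X₀ (e k) (e k) -
      κ k * fderiv ℝ φ X₀ (normal ρ X₀))) ≤ R * (1 + κ k) := by
    have h1 := abs_fderiv_fderiv_le hA (e k)
    have h2 := abs_fderiv_le hA (normal ρ X₀)
    rw [hen, one_pow, mul_one] at h1
    rw [hF.norm_normal, mul_one] at h2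
    have h3 : -(fderiv ℝ (fderiv ℝ φ) X₀ (e k) (e k)) + κ k * fderiv ℝ φ X₀ (normal ρ X₀) ≤
        A * (1 + κ k) := by
      have := mul_le_mul_of_nonneg_left ((le_abs_self _).trans h2) hk
      linarith [(neg_le_abs _).trans h1]
    calc _ = u ^ α * (-(fderiv ℝ (fderiv ℝ φ) X₀ (e k) (e k)) +
          κ k * fderiv ℝ φ X₀ (normal ρ X₀)) := by ring
      _ ≤ u ^ α * (A * (1 + κ k)) := by gcongr
      _ ≤ P * (A * (1 + κ k)) := by gcongr
      _ = (P * A) * (1 + κ k) := by ring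
      _ ≤ R * (1 + κ k) := by
        gcongr
        rw [hRdef]; linarith
  have hmain := curvature_inequality_at_max hρ hX₀ hφ heq hF hdiag hκ hφ₀ k hmax hu hf
    (ψ := fun v => u ^ α * fderiv ℝ φ X₀ v) (fun _ => rfl) (x := fun i => ⟪X₀, e i⟫)
    (fun _ => rfl) rfl
  have hrhs := curvature_rhs_le (α := α) hk hu0 hf0 huR hfR hfR' hy hψ hS hΨ
  have hgap := one_add_mul_sq_ge (y := ⟪X₀, e k⟫ / u) hu0 huN hα' (by
    rw [div_pow, mul_div_cancel₀ _ (by positivity)]; exact hxk)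
  have hratio : (c / K) ^ 2 ≤ u ^ 2 / N ^ 2 := by
    rw [← div_pow]; gcongr
  have hfinv : R⁻¹ ≤ f := by
    rw [← inv_inv f]
    exact inv_anti₀ (inv_pos.2 hf0) (by rwa [← one_div])
  have h2α : 0 < 2 - α := by linarith
  refine le_of_mul_sq_le (by positivity) (by positivity) (le_trans ?_ (hmain.trans hrhs))
  calc R⁻¹ * (2 - α) * (c / K) ^ 2 * κ k ^ 2
      ≤ f * (2 - α) * (1 + (1 - α) * (⟪X₀, e k⟫ / u) ^ 2) * κ k ^ 2 := by
        gcongr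
        exact hratio.trans hgap
    _ = _ := by ring

end

end StarShaped

end

/-! ### Proof of the theorem -/

open StarShaped

theorem theorem1p4 (n : ℕ) (hn : 2 ≤ n) (α A B K : ℝ) :
    ∃ C : ℝ, ∀ (ρ φ : StarShaped.E n → ℝ),
      StarShaped.IsRadialFunction 4 ρ →
      StarShaped.C1Bound ρ K →
      ContDiff ℝ 2 φ →
      (∀ X, 0 < φ X) →
      (∀ X ∈ StarShaped.hypersurface ρ, ∀ j ≤ 2, ‖iteratedFDeriv ℝ j φ X‖ ≤ A) →
      (∀ X ∈ StarShaped.hypersurface ρ, 1 / φ X ≤ B) →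
      StarShaped.IsKConvex 2 ρ →
      (∀ X ∈ StarShaped.hypersurface ρ,
        StarShaped.sigma 2 ρ X = φ X * StarShaped.support ρ X ^ α) →
      α < 1 + StarShaped.delta ρ →
      ∀ X ∈ StarShaped.hypersurface ρ, ∀ ξ : StarShaped.tangent ρ X, ‖ξ‖ = 1 →
        StarShaped.secondFF ρ X ξ ξ ≤ C := by
  -- The two extra factors bound the support function at X and its reciprocal at X₀.
  refine ⟨K * (K + K ^ 3) * curvatureBound α A B K, ?_⟩
  intro ρ φ hρ hK hφ hφpos hA hB hconv heq hα X hX ξ hξ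
  obtain ⟨X₀, hX₀, ξ₀, hξ₀, hmax⟩ := hρ.exists_max_secondFF hX ξ hξ
  have hN := hρ.norm_normal (ne_zero_of_definingFun_eq_one (hρ.mem_hypersurface_iff.1 hX₀))
  have hS := hρ.isSymmetric_shapeOperator hX₀
  have hfin := finrank_tangent hN
  let b := hS.eigenvectorBasis hfin
  let κ := hS.eigenvalues hfin
  have hb : ∀ i, shapeOperator ρ X₀ (b i) = κ i • b i := fun i =>
    hS.apply_eigenvectorBasis hfin i
  -- Eigenvalues are listed in decreasing order, so index 0 is the largest.
  let k : Fin n := ⟨0, by omega⟩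
  have hle : ∀ i, κ i ≤ κ k := fun i =>
    hS.eigenvalues_antitone hfin (Fin.mk_le_of_le_val i.1.zero_le)
  have hκ : 0 < ∑ i, κ i := by
    have h := hconv X₀ hX₀ 1 le_rfl (by norm_num)
    rw [hρ.sigma_one_eq hX₀, hS.trace_eq_sum_eigenvalues hfin] at h
    exact h
  have hk : 0 < κ k := by
    by_contra! h
    exact hκ.not_ge (Finset.sum_nonpos fun i _ => (hle i).trans h)
  have hdiag : ∀ i j, ⟪fderiv ℝ (normal ρ) X₀ (b i : E n), (b j : E n)⟫ =
      if i = j then κ i else 0 := by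
    intro i j
    change secondFF ρ X₀ (b i) (b j) = _
    rw [← inner_shapeOperator, hb, inner_smul_left, orthonormal_iff_ite.1 b.orthonormal]
    simp
  have hu0 := hρ.support_pos hX₀
  -- The maximising vector need not be an eigenvector from the chosen basis. This upper bound
  -- suffices to replace its curvature by κ_k in the maximality inequality.
  have hξκ : secondFF ρ X₀ ξ₀ ξ₀ ≤ κ k := by
    rw [← inner_shapeOperator, ← b.sum_inner_mul_inner]
    have h1 : ∀ i, ⟪shapeOperator ρ X₀ ξ₀, b i⟫ = κ i * ⟪ξ₀, b i⟫ := fun i => by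
      rw [hS, hb, inner_smul_right]
    have h2 : ∑ i, ⟪ξ₀, b i⟫ * ⟪b i, ξ₀⟫ = 1 := by
      rw [b.sum_inner_mul_inner, real_inner_self_eq_norm_sq, hξ₀, one_pow]
    calc ∑ i, ⟪shapeOperator ρ X₀ ξ₀, b i⟫ * ⟪b i, ξ₀⟫
        ≤ ∑ i, κ k * (⟪ξ₀, b i⟫ * ⟪b i, ξ₀⟫) := by
          refine Finset.sum_le_sum fun i _ => ?_
          rw [h1, mul_assoc]
          refine mul_le_mul_of_nonneg_right (hle i) ?_
          rw [real_inner_comm]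
          exact mul_self_nonneg _
      _ = κ k := by rw [← Finset.mul_sum, h2, mul_one]
  have hmax' : ∀ Y ∈ hypersurface ρ, ∀ η : tangent ρ Y, ‖η‖ = 1 →
      secondFF ρ Y η η ≤ κ k / support ρ X₀ * support ρ Y := by
    intro Y hY η hη
    have h1 := (hmax Y hY η hη).trans (div_le_div_of_nonneg_right hξκ hu0.le)
    rwa [div_le_iff₀ (hρ.support_pos hY)] at h1
  have hmaxv : ∀ Y ∈ hypersurface ρ, ∀ v ∈ tangent ρ Y,
      ⟪fderiv ℝ (normal ρ) Y v, v⟫ ≤ κ k / support ρ X₀ * support ρ Y * ‖v‖ ^ 2 :=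
    fun Y hY v hv => inner_fderiv_normal_le (hmax' Y hY) hv
  have hbound := curvature_le_at_max hρ hX₀ hφ hK (hA X₀ hX₀) (hB X₀ hX₀) (hφpos X₀) hα heq
    (isFrame_of_orthonormalBasis hN b) hdiag hκ k hk.le hmaxv
  have hK0 := hρ.bound_pos hK hX₀
  have hinv : (support ρ X₀)⁻¹ ≤ K + K ^ 3 := by
    rw [← inv_inv (K + K ^ 3)]
    exact inv_anti₀ (by positivity) (hρ.support_ge hK hX₀)
  calc secondFF ρ X ξ ξ ≤ κ k / support ρ X₀ * support ρ X := hmax' X hX ξ hξ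
    _ = support ρ X * (support ρ X₀)⁻¹ * κ k := by ring
    _ ≤ K * (K + K ^ 3) * curvatureBound α A B K := by
      have := (hρ.support_le_norm hX).trans (hρ.norm_le hK hX)
      gcongr
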